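/- Let $H_2\subset H_1$ be separable real Hilbert spaces such that the inclusion is dense and $|x|_1\le|x|_2$ for all $x\in H_2$ (the inclusion need not be compact). Let $U_1\subset H_1$ be open with $0\in U_1$, put $U_2:=U_1\cap H_2$, and let $\phi\colon U_1\to H_1$ be $(H_1,H_2)$-tame with $\phi(0)=0$. Here tame means: $\phi$ is $C^2$; $\phi$ restricts to a $C^2$ map $U_2\to H_2$; and every $x\in U_1$ has an $H_1$-open neighborhood $W_x\subset U_1$ and a constant $\kappa>0$ such that for all $y\in W_x\cap H_2$ and $\xi,\eta\in H_2$ $$|d^2\phi|_y(\xi,\eta)|_2\le\kappa\bigl(|\xi|_1|\eta|_2+|\xi|_2|\eta|_1+|y|_2|\xi|_1|\eta|_1\bigr).$$ Let $\mathcal W:=W^{1,2}(\mathbb R,H_1)\cap L^2(\mathbb R,H_2)$ with the norm $\bigl(\|\xi\|_{L^2(\mathbb R,H_2)}^2+\|\dot\xi\|_{L^2(\mathbb R,H_1)}^2\bigr)^{1/2}$, where $\dot\xi$ is the weak derivative, and let $\mathcal U:=\{\xi\in\mathcal W\mid \xi(s)\in U_1\text{ for all }s\in\mathbb R\}$, where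 $\xi(s)$ is the value of the continuous representative $\mathbb R\to H_1$ of $\xi$. Then: (a) $\mathcal U$ is open in $\mathcal W$, and $\Phi\colon\mathcal U\to\mathcal W$, $\Phi(\xi)=\phi\circ\xi$, is well defined and continuously differentiable, with $(d\Phi|_\xi\zeta)(s)=d\phi|_{\xi(s)}\zeta(s)$ for all $\xi\in\mathcal U$, $\zeta\in\mathcal W$ and almost every $s$. (b) The weak tangent map $T\Phi\colon\mathcal U\times L^2(\mathbb R,H_1)\to\mathcal W\times L^2(\mathbb R,H_1)$, $T\Phi(\xi,\eta)=(\phi\circ\xi,\ d\phi|_{\xi}\,\eta)$, where $(d\phi|_\xi\eta)(s)=d\phi|_{\xi(s)}\eta(s)$, is well defined and continuously differentiable. -/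

import Mathlib

open MeasureTheory Set
open scoped ContDiff

/-- `v` is a weak derivative of `f : ℝ → H`: integration by parts holds against every smooth
compactly supported test function `χ : ℝ → H`. -/
def IsWeakDeriv {H : Type*} [NormedAddCommGroup H] [InnerProductSpace ℝ H]
    (f v : ℝ → H) : Prop :=
  ∀ χ : ℝ → H, ContDiff ℝ ∞ χ → HasCompactSupport χ →
    ∫ t, inner ℝ (f t) (deriv χ t) = -∫ t, inner ℝ (v t) (χ t)

/-- Membership in the Sobolev space `W^{1,2}(ℝ, H)`. -/
def MemW12 {H : Type*} [NormedAddCommGroup H] [InnerProductSpace ℝ H] (f : ℝ → H) : Prop :=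
  MemLp f 2 volume ∧ ∃ v : ℝ → H, MemLp v 2 volume ∧ IsWeakDeriv f v

theorem integrable_inner_of_memLp_two {H : Type*} [NormedAddCommGroup H] [InnerProductSpace ℝ H]
    {f g : ℝ → H} (hf : MemLp f 2 volume) (hg : MemLp g 2 volume) :
    Integrable (fun t => inner ℝ (f t) (g t)) volume := by
  have h := L2.integrable_inner (𝕜 := ℝ) (hf.toLp f) (hg.toLp g)
  refine h.congr ?_
  filter_upwards [hf.coeFn_toLp, hg.coeFn_toLp] with t h1 h2
  rw [h1, h2]

theorem memLp_two_of_test {H : Type*} [NormedAddCommGroup H] [InnerProductSpace ℝ H]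
    {χ : ℝ → H} (hχ : ContDiff ℝ ∞ χ) (hc : HasCompactSupport χ) : MemLp χ 2 volume :=
  hχ.continuous.memLp_of_hasCompactSupport hc

theorem memLp_two_of_test_deriv {H : Type*} [NormedAddCommGroup H] [InnerProductSpace ℝ H]
    {χ : ℝ → H} (hχ : ContDiff ℝ ∞ χ) (hc : HasCompactSupport χ) :
    MemLp (deriv χ) 2 volume :=
  (hχ.continuous_deriv (by simp)).memLp_of_hasCompactSupport hc.deriv

theorem IsWeakDeriv.congr {H : Type*} [NormedAddCommGroup H] [InnerProductSpace ℝ H]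
    {f f' v v' : ℝ → H} (h : IsWeakDeriv f v) (hf : f =ᵐ[volume] f') (hv : v =ᵐ[volume] v') :
    IsWeakDeriv f' v' := by
  intro χ h1 h2
  have e1 : ∫ t, inner ℝ (f' t) (deriv χ t) = ∫ t, inner ℝ (f t) (deriv χ t) := by
    apply integral_congr_ae
    filter_upwards [hf] with t ht
    rw [ht]
  have e2 : ∫ t, inner ℝ (v' t) (χ t) = ∫ t, inner ℝ (v t) (χ t) := by
    apply integral_congr_ae
    filter_upwards [hv] with t ht
    rw [ht]
  rw [e1, e2]
  exact h χ h1 h2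

theorem IsWeakDeriv.add {H : Type*} [NormedAddCommGroup H] [InnerProductSpace ℝ H]
    {f g v w : ℝ → H} (hf : MemLp f 2 volume) (hg : MemLp g 2 volume)
    (hv : MemLp v 2 volume) (hw : MemLp w 2 volume)
    (h : IsWeakDeriv f v) (h' : IsWeakDeriv g w) : IsWeakDeriv (f + g) (v + w) := by
  intro χ h1 h2
  have d1 := memLp_two_of_test h1 h2
  have d2 := memLp_two_of_test_deriv h1 h2
  simp only [Pi.add_apply, inner_add_left]
  rw [integral_add (integrable_inner_of_memLp_two hf d2) (integrable_inner_of_memLp_two hg d2),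
    integral_add (integrable_inner_of_memLp_two hv d1) (integrable_inner_of_memLp_two hw d1),
    h χ h1 h2, h' χ h1 h2, neg_add]

theorem IsWeakDeriv.smul {H : Type*} [NormedAddCommGroup H] [InnerProductSpace ℝ H]
    {f v : ℝ → H} (c : ℝ) (h : IsWeakDeriv f v) : IsWeakDeriv (c • f) (c • v) := by
  intro χ h1 h2
  simp only [Pi.smul_apply, real_inner_smul_left, integral_const_mul]
  rw [h χ h1 h2, mul_neg]

theorem IsWeakDeriv.zero {H : Type*} [NormedAddCommGroup H] [InnerProductSpace ℝ H] :
    IsWeakDeriv (0 : ℝ → H) 0 := by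
  intro χ _ _
  simp

/-- Weak derivatives are unique almost everywhere. -/
theorem IsWeakDeriv.ae_unique {H : Type*} [NormedAddCommGroup H] [InnerProductSpace ℝ H]
    [CompleteSpace H] {f v w : ℝ → H} (hv : MemLp v 2 volume) (hw : MemLp w 2 volume)
    (h : IsWeakDeriv f v) (h' : IsWeakDeriv f w) : v =ᵐ[volume] w := by
  have hvw : MemLp (v - w) 2 volume := hv.sub hw
  have hloc : LocallyIntegrable (v - w) volume := hvw.locallyIntegrable (by norm_num)
  have key : ∀ᵐ t ∂(volume : Measure ℝ), (v - w) t = 0 := by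
    apply ae_eq_zero_of_integral_contDiff_smul_eq_zero hloc
    intro g hg hgc
    refine ext_inner_left ℝ fun x => ?_
    have hi : Integrable (fun t => g t • (v - w) t) volume :=
      hloc.integrable_smul_left_of_hasCompactSupport hg.continuous hgc
    rw [inner_zero_right, ← integral_inner hi x]
    have hχ : ContDiff ℝ ∞ (fun t => g t • x) := hg.smul contDiff_const
    have hχc : HasCompactSupport (fun t => g t • x) := hgc.smul_right
    have d1 := memLp_two_of_test hχ hχc
    have e1 := h _ hχ hχc
    have e2 := h' _ hχ hχc
    have e3 : ∫ t, inner ℝ (v t) (g t • x) = ∫ t, inner ℝ (w t) (g t • x) := by linarith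
    have e4 : ∀ t, inner ℝ x (g t • (v - w) t)
        = inner ℝ (v t) (g t • x) - inner ℝ (w t) (g t • x) := by
      intro t
      rw [Pi.sub_apply, real_inner_smul_right, inner_smul_right, inner_smul_right,
        inner_sub_right, real_inner_comm x, real_inner_comm x]
      ring
    simp only [e4]
    rw [integral_sub (integrable_inner_of_memLp_two hv d1) (integrable_inner_of_memLp_two hw d1),
      e3, sub_self]
  filter_upwards [key] with t ht
  exact sub_eq_zero.mp ht

/-- The Hilbert space `W^{1,2}(ℝ, H₁) ∩ L²(ℝ, H₂)`, for a continuous inclusion `ι : H₂ → H₁`.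
A path `ξ ∈ L²(ℝ, H₂)` with `ι ∘ ξ ∈ W^{1,2}(ℝ, H₁)` is recorded together with its (unique) weak
derivative, i.e. as the pair `(ξ, ξ')` in the Hilbert sum `L²(ℝ, H₂) ⊕ L²(ℝ, H₁)`; the inherited
norm is `(‖ξ‖²_{L²(ℝ, H₂)} + ‖ξ'‖²_{L²(ℝ, H₁)})^{1/2}`. -/
def pathSpace {H₁ H₂ : Type*} [NormedAddCommGroup H₁] [InnerProductSpace ℝ H₁]
    [NormedAddCommGroup H₂] [InnerProductSpace ℝ H₂] (ι : H₂ →L[ℝ] H₁) :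
    Submodule ℝ (WithLp 2 (Lp H₂ 2 (volume : Measure ℝ) × Lp H₁ 2 (volume : Measure ℝ))) where
  carrier := {p | IsWeakDeriv (fun t => ι (p.fst t)) p.snd}
  zero_mem' := by
    refine IsWeakDeriv.zero.congr ?_ ?_
    · filter_upwards [Lp.coeFn_zero H₂ 2 (volume : Measure ℝ)] with t ht
      rw [WithLp.zero_fst, ht]
      simp
    · exact (Lp.coeFn_zero H₁ 2 (volume : Measure ℝ)).symm
  add_mem' := by
    intro p q hp hq
    have m1 : MemLp (fun t => ι (p.fst t)) 2 volume := ι.comp_memLp' (Lp.memLp p.fst)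
    have m2 : MemLp (fun t => ι (q.fst t)) 2 volume := ι.comp_memLp' (Lp.memLp q.fst)
    refine (IsWeakDeriv.add m1 m2 (Lp.memLp p.snd) (Lp.memLp q.snd) hp hq).congr ?_ ?_
    · filter_upwards [Lp.coeFn_add p.fst q.fst] with t ht
      rw [WithLp.add_fst, ht]
      simp
    · exact (Lp.coeFn_add p.snd q.snd).symm
  smul_mem' := by
    intro c p hp
    refine (IsWeakDeriv.smul c hp).congr ?_ ?_
    · filter_upwards [Lp.coeFn_smul c p.fst] with t ht
      rw [WithLp.smul_fst, ht]
      simp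
    · exact (Lp.coeFn_smul c p.snd).symm

/-- The underlying path `ξ ∈ L²(ℝ, H₂)` of an element of `pathSpace ι`. -/
def pathOf {H₁ H₂ : Type*} [NormedAddCommGroup H₁] [InnerProductSpace ℝ H₁]
    [NormedAddCommGroup H₂] [InnerProductSpace ℝ H₂] {ι : H₂ →L[ℝ] H₁} (ξ : pathSpace ι) :
    Lp H₂ 2 (volume : Measure ℝ) :=
  ξ.1.fst

/-- An element of `pathSpace ι` is determined by its underlying path. -/
theorem pathOf_injective {H₁ H₂ : Type*} [NormedAddCommGroup H₁] [InnerProductSpace ℝ H₁]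
    [CompleteSpace H₁] [NormedAddCommGroup H₂] [InnerProductSpace ℝ H₂] {ι : H₂ →L[ℝ] H₁} :
    Function.Injective (pathOf : pathSpace ι → Lp H₂ 2 (volume : Measure ℝ)) := by
  rintro ⟨⟨p1, p2⟩, hp⟩ ⟨⟨q1, q2⟩, hq⟩ h
  have h1 : p1 = q1 := h
  subst h1
  have h2 : p2 = q2 := Lp.ext (IsWeakDeriv.ae_unique (Lp.memLp p2) (Lp.memLp q2) hp hq)
  subst h2
  rfl

/-- The paths underlying `pathSpace ι` are exactly the `ξ ∈ L²(ℝ, H₂)` with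
`ι ∘ ξ ∈ W^{1,2}(ℝ, H₁)`. -/
theorem exists_pathOf_iff {H₁ H₂ : Type*} [NormedAddCommGroup H₁]
    [InnerProductSpace ℝ H₁] [NormedAddCommGroup H₂] [InnerProductSpace ℝ H₂]
    {ι : H₂ →L[ℝ] H₁} (f : Lp H₂ 2 (volume : Measure ℝ)) :
    (∃ ξ : pathSpace ι, pathOf ξ = f) ↔ MemW12 (fun t => ι (f t)) := by
  constructor
  · rintro ⟨ξ, rfl⟩
    exact ⟨ι.comp_memLp' (Lp.memLp (pathOf ξ)), ξ.1.snd, Lp.memLp _, ξ.2⟩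
  · rintro ⟨_, v, hv, h⟩
    exact ⟨⟨WithLp.toLp 2 (f, hv.toLp v),
      h.congr (Filter.EventuallyEq.refl _ _) hv.coeFn_toLp.symm⟩, rfl⟩

/-- The set `𝒰` of all paths `ξ ∈ W^{1,2}(ℝ, H₁) ∩ L²(ℝ, H₂)` with `ξ(s) ∈ U₁` for every `s`,
where `ξ(s)` is the value at `s` of the continuous representative of `ξ` as a map to `H₁`. -/
def pathDomain {H₁ H₂ : Type*} [NormedAddCommGroup H₁] [InnerProductSpace ℝ H₁]
    [NormedAddCommGroup H₂] [InnerProductSpace ℝ H₂] (ι : H₂ →L[ℝ] H₁) (U₁ : Set H₁) :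
    Set (pathSpace ι) :=
  {ξ | ∃ f : ℝ → H₁, Continuous f ∧ f =ᵐ[volume] (fun s => ι (pathOf ξ s)) ∧ ∀ s, f s ∈ U₁}

/-- `φ : U₁ → H₁` is `(H₁, H₂)`-tame, for `U₁ ⊆ H₁` open and a continuous inclusion `ι : H₂ → H₁`:
it is `C²` on `U₁`, it restricts to a `C²` map `ψ` from `U₂ = U₁ ∩ H₂` (an open subset of `H₂`) to
`H₂`, and the second derivative of the restriction satisfies the taming estimate locally
uniformly on `U₁`. Only the values of `φ` on `U₁` and of `ψ` on `U₂` matter. -/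
def IsTame {H₁ H₂ : Type*} [NormedAddCommGroup H₁] [InnerProductSpace ℝ H₁]
    [NormedAddCommGroup H₂] [InnerProductSpace ℝ H₂] (ι : H₂ →L[ℝ] H₁) (U₁ : Set H₁)
    (φ : H₁ → H₁) : Prop :=
  ContDiffOn ℝ 2 φ U₁ ∧
  ∃ ψ : H₂ → H₂,
    (∀ y, ι y ∈ U₁ → ι (ψ y) = φ (ι y)) ∧
    ContDiffOn ℝ 2 ψ (ι ⁻¹' U₁) ∧
    ∀ x ∈ U₁, ∃ W : Set H₁, IsOpen W ∧ x ∈ W ∧ W ⊆ U₁ ∧ ∃ κ : ℝ, 0 < κ ∧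
      ∀ y : H₂, ι y ∈ W → ∀ ξ η : H₂,
        ‖fderiv ℝ (fderiv ℝ ψ) y ξ η‖ ≤
          κ * (‖ι ξ‖ * ‖η‖ + ‖ξ‖ * ‖ι η‖ + ‖y‖ * ‖ι ξ‖ * ‖ι η‖)

/-! A path has a continuous `H₁`-valued representative, bounded by a multiple of its norm and
tending to `0` at infinity. Since `0 ∈ U₁`, its range together with `0` is a compact subset of `U₁`.
This compactness replaces compactness of the inclusion: it gives openness of the domain and
constants uniform in `s`.

The `L²(H₁)` components need only sup-norm control. Superposition by a `C¹` map is `C¹` on bounded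
continuous functions, and multiplication of `L²` by bounded continuous operator functions is bounded
bilinear. As `dφ` is `C¹`, the map `(ξ, η) ↦ dφ(ξ) η` is therefore `C¹`
(`contDiffOn_mulLp_superpose`). It is the second component of `TΦ` and, at `η = ξ'`, the weak
derivative of `φ ∘ ξ` (`isWeakDeriv_comp_primitive`).

The `L²(H₂)` component is where tameness enters, because paths are not bounded in `H₂`. Each term of
the taming estimate has exactly one `H₂`-norm; that factor is measured in `L²` and the others in the
`H₁` sup norm. Integrating the estimate along segments gives a quadratic Taylor remainder for `ξ ↦ ψ
∘ ξ` and a locally Lipschitz derivative (`exists_superposeLp_estimates`). -/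

/-! ### Absolute continuity and the weak chain rule. -/

theorem AbsolutelyContinuousOnInterval.of_dist_le {X Y Z : Type*} [PseudoMetricSpace X]
    [PseudoMetricSpace Y] [PseudoMetricSpace Z] {f : ℝ → X} {g : ℝ → Y} {h : ℝ → Z} {a b K : ℝ}
    (hf : AbsolutelyContinuousOnInterval f a b) (hg : AbsolutelyContinuousOnInterval g a b)
    (H : ∀ x ∈ uIcc a b, ∀ y ∈ uIcc a b,
      dist (h x) (h y) ≤ K * (dist (f x) (f y) + dist (g x) (g y))) :
    AbsolutelyContinuousOnInterval h a b := by
  unfold AbsolutelyContinuousOnInterval at hf hg ⊢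
  refine squeeze_zero' (.of_forall fun _ => Finset.sum_nonneg fun _ _ => dist_nonneg) ?_
    (by simpa using (hf.add hg).const_mul K)
  rw [Filter.eventually_inf_principal]
  filter_upwards with E hE
  rw [← Finset.sum_add_distrib, Finset.mul_sum]
  exact Finset.sum_le_sum fun i hi => H _ (hE.1 i hi).1 _ (hE.1 i hi).2

theorem MeasureTheory.LocallyIntegrable.intervalIntegrable_real {E : Type*} [NormedAddCommGroup E]
    {v : ℝ → E} (hv : LocallyIntegrable v volume) (a b : ℝ) : IntervalIntegrable v volume a b :=
  intervalIntegrable_iff.mpr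
    ((hv.integrableOn_isCompact isCompact_uIcc).mono_set uIoc_subset_uIcc)

theorem MeasureTheory.LocallyIntegrable.absolutelyContinuousOnInterval_primitive {E : Type*}
    [NormedAddCommGroup E] [NormedSpace ℝ E] {v : ℝ → E} (hv : LocallyIntegrable v volume)
    (c : E) (a b : ℝ) :
    AbsolutelyContinuousOnInterval (fun t => c + ∫ u in (0 : ℝ)..t, v u) a b := by
  have hn : LocallyIntegrable (fun t => ‖v t‖) volume :=
    fun x => (hv x).norm
  have h1 : AbsolutelyContinuousOnInterval (fun x => ∫ u in a..x, ‖v u‖) a b :=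
    (hn.intervalIntegrable_real a b).absolutelyContinuousOnInterval_intervalIntegral left_mem_uIcc
  -- One comparison function is enough here, so it is passed twice.
  refine h1.of_dist_le h1 (K := 1) fun x _ y _ => ?_
  rw [dist_eq_norm, dist_eq_norm, add_sub_add_left_eq_sub,
    intervalIntegral.integral_interval_sub_left (hv.intervalIntegrable_real _ _)
      (hv.intervalIntegrable_real _ _),
    intervalIntegral.integral_interval_sub_left (hn.intervalIntegrable_real _ _)
      (hn.intervalIntegrable_real _ _)]
  have := intervalIntegral.norm_integral_le_abs_integral_norm (f := v) (a := y) (b := x)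
    (μ := volume)
  rw [Real.norm_eq_abs]
  linarith [abs_nonneg (∫ u in y..x, ‖v u‖)]

theorem continuous_add_primitive {E : Type*}
    [NormedAddCommGroup E] [NormedSpace ℝ E] {v : ℝ → E} (hv : LocallyIntegrable v volume)
    (c : E) : Continuous (fun t => c + ∫ u in (0 : ℝ)..t, v u) :=
  continuous_const.add (intervalIntegral.continuous_primitive
    (fun a b => hv.intervalIntegrable_real a b) 0)

/-- `K` need not be convex (it will be the image of a curve), so local Lipschitz constants are
patched by compactness instead of integrating along segments. -/
theorem ContDiffOn.exists_lipschitzOnWith_of_isCompact {E F : Type*} [NormedAddCommGroup E]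
    [NormedSpace ℝ E] [NormedAddCommGroup F] [NormedSpace ℝ F] {f : E → F} {U K : Set E}
    (hU : IsOpen U) (hf : ContDiffOn ℝ 1 f U) (hK : IsCompact K) (hKU : K ⊆ U) :
    ∃ C, LipschitzOnWith C f K := by
  refine LocallyLipschitzOn.exists_lipschitzOnWith_of_compact hK fun x hx => ?_
  obtain ⟨C, t, ht, h⟩ :=
    (hf.contDiffAt (hU.mem_nhds (hKU hx))).exists_lipschitzOnWith
  exact ⟨C, t, mem_nhdsWithin_of_mem_nhds ht, h⟩

/-- The weak chain rule for a `C¹` map along an absolutely continuous curve. -/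
theorem isWeakDeriv_comp_primitive {H : Type*} [NormedAddCommGroup H] [InnerProductSpace ℝ H]
    [CompleteSpace H] {U : Set H} (hU : IsOpen U) {φ : H → H} (hφ : ContDiffOn ℝ 1 φ U)
    {g v : ℝ → H} (hv : LocallyIntegrable v volume) (c : H)
    (hg : ∀ t, g t = c + ∫ u in (0 : ℝ)..t, v u) (hgU : ∀ t, g t ∈ U) :
    IsWeakDeriv (fun t => φ (g t)) (fun t => fderiv ℝ φ (g t) (v t)) := by
  intro χ hχ hχc
  obtain rfl : g = fun t => c + ∫ u in (0 : ℝ)..t, v u := funext hg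
  set g := fun t => c + ∫ u in (0 : ℝ)..t, v u with hgdef
  have hgc : Continuous g := continuous_add_primitive hv c
  obtain ⟨R, hR⟩ := hχc.isCompact.isBounded.subset_closedBall 0
  have hsupp : ∀ x, x ∉ Ioc (-(|R| + 1)) (|R| + 1) → χ x = 0 ∧ deriv χ x = 0 := by
    intro x hx
    have hx' : x ∉ tsupport χ := by
      intro h
      have := hR h
      rw [Metric.mem_closedBall, Real.dist_eq, sub_zero] at this
      have h2 := abs_le.1 (this.trans (le_abs_self R))
      exact hx ⟨by linarith, by linarith⟩
    exact ⟨image_eq_zero_of_notMem_tsupport hx', by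
      by_contra h
      exact hx' (support_deriv_subset h)⟩
  set b := |R| + 1 with hb
  have hφc : Continuous fun t => φ (g t) := hφ.continuousOn.comp_continuous hgc hgU
  have hχ1 : ContDiff ℝ 1 χ := hχ.of_le (by simp)
  have hχ'c : Continuous (deriv χ) := hχ.continuous_deriv (by simp)
  have hKc : IsCompact (g '' uIcc (-b) b) := isCompact_uIcc.image hgc
  obtain ⟨C, hC⟩ := hφ.exists_lipschitzOnWith_of_isCompact hU hKc
    (by rintro _ ⟨t, -, rfl⟩; exact hgU t)
  have hφac : AbsolutelyContinuousOnInterval (fun t => φ (g t)) (-b) b := by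
    have h1 := hv.absolutelyContinuousOnInterval_primitive c (-b) b
    refine h1.of_dist_le h1 (K := C) fun x hx y hy => ?_
    have := hC.dist_le_mul _ (mem_image_of_mem g hx) _ (mem_image_of_mem g hy)
    refine this.trans (mul_le_mul_of_nonneg_left ?_ C.2)
    exact le_add_of_nonneg_right dist_nonneg
  have hχac : AbsolutelyContinuousOnInterval χ (-b) b :=
    hχ1.contDiffOn.absolutelyContinuousOnInterval
  obtain ⟨M, hM⟩ := hφac.exists_bound
  obtain ⟨N, hN⟩ := hχac.exists_bound
  -- Absolute continuity of the pairing allows the fundamental theorem of calculus; with the almost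
  -- everywhere product rule this is integration by parts on `[-b, b]`.
  have hac : AbsolutelyContinuousOnInterval (fun t => inner ℝ (φ (g t)) (χ t)) (-b) b := by
    refine hφac.of_dist_le hχac (K := max M N) fun x hx y hy => ?_
    have e : inner ℝ (φ (g x)) (χ x) - inner ℝ (φ (g y)) (χ y) =
        inner ℝ (φ (g x) - φ (g y)) (χ x) + inner ℝ (φ (g y)) (χ x - χ y) := by
      rw [inner_sub_left, inner_sub_right]; ring
    rw [Real.dist_eq, e, dist_eq_norm, dist_eq_norm]
    have i1 := abs_real_inner_le_norm (φ (g x) - φ (g y)) (χ x)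
    have i2 := abs_real_inner_le_norm (φ (g y)) (χ x - χ y)
    have j1 : ‖χ x‖ ≤ max M N := (hN x hx).trans (le_max_right _ _)
    have j2 : ‖φ (g y)‖ ≤ max M N := (hM y hy).trans (le_max_left _ _)
    calc _ ≤ _ := abs_add_le _ _
      _ ≤ ‖φ (g x) - φ (g y)‖ * max M N + max M N * ‖χ x - χ y‖ := by
        refine add_le_add (i1.trans ?_) (i2.trans ?_) <;> gcongr
      _ = _ := by ring
  have hder : ∀ᵐ t, deriv (fun t => inner ℝ (φ (g t)) (χ t)) t =
      inner ℝ (φ (g t)) (deriv χ t) + inner ℝ (fderiv ℝ φ (g t) (v t)) (χ t) := by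
    filter_upwards [_root_.LocallyIntegrable.ae_hasDerivAt_integral hv] with t ht
    have d1 : HasDerivAt g (v t) t := (ht 0).const_add c
    have d2 : HasFDerivAt φ (fderiv ℝ φ (g t)) (g t) :=
      ((hφ.contDiffAt (hU.mem_nhds (hgU t))).differentiableAt (by simp)).hasFDerivAt
    have d3 := d2.comp_hasDerivAt t d1
    have d4 : HasDerivAt χ (deriv χ t) t := (hχ1.differentiable (by simp) t).hasDerivAt
    exact (d3.inner ℝ d4).deriv
  have hint := hac.integral_deriv_eq_sub
  have hi1 : IntervalIntegrable (fun t => inner ℝ (φ (g t)) (deriv χ t)) volume (-b) b :=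
    (hφc.inner hχ'c).intervalIntegrable _ _
  have hi2 : IntervalIntegrable (fun t => inner ℝ (fderiv ℝ φ (g t) (v t)) (χ t))
      volume (-b) b := by
    refine (hac.intervalIntegrable_deriv.sub hi1).congr_ae ?_
    refine ae_restrict_of_ae ?_
    filter_upwards [hder] with t ht
    simp [ht]
  rw [intervalIntegral.integral_congr_ae (hder.mono fun t ht _ => ht),
    intervalIntegral.integral_add hi1 hi2,
    intervalIntegral.integral_eq_integral_of_support_subset,
    intervalIntegral.integral_eq_integral_of_support_subset] at hint
  -- The right endpoint belongs to the half-open interval in `hsupp`, so it needs its own argument.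
  · have e1 : χ b = 0 := by
      by_contra h
      have := hR (subset_tsupport _ h)
      rw [Metric.mem_closedBall, Real.dist_eq, sub_zero] at this
      have h2 := abs_le.1 (this.trans (le_abs_self R))
      linarith
    have e2 : χ (-b) = 0 := (hsupp _ (by simp)).1
    rw [e1, e2] at hint
    simp only [inner_zero_right, sub_zero] at hint
    linarith
  · intro x hx
    by_contra h
    exact hx (by simp [(hsupp x h).1])
  · intro x hx
    by_contra h
    exact hx (by simp [(hsupp x h).2])

theorem isWeakDeriv_primitive {H : Type*} [NormedAddCommGroup H] [InnerProductSpace ℝ H]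
    [CompleteSpace H] {v : ℝ → H} (hv : LocallyIntegrable v volume) :
    IsWeakDeriv (fun t => ∫ u in (0 : ℝ)..t, v u) v := by
  have := isWeakDeriv_comp_primitive isOpen_univ (φ := id) contDiff_id.contDiffOn hv 0
    (g := fun t => ∫ u in (0 : ℝ)..t, v u) (by simp) (by simp)
  simpa using this

/-! ### Functions with a weak derivative are primitives. -/

/-- The du Bois-Reymond lemma. -/
theorem exists_ae_eq_const_of_integral_inner_deriv_eq_zero {H : Type*} [NormedAddCommGroup H]
    [InnerProductSpace ℝ H] [CompleteSpace H] {g : ℝ → H} (hg : LocallyIntegrable g volume)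
    (h : ∀ χ : ℝ → H, ContDiff ℝ ∞ χ → HasCompactSupport χ →
      ∫ t, inner ℝ (g t) (deriv χ t) = 0) :
    ∃ c : H, g =ᵐ[volume] fun _ => c := by
  let B : ContDiffBump (0 : ℝ) := ⟨1, 2, by norm_num, by norm_num⟩
  set ρ := B.normed volume with hρ
  have hρs : ContDiff ℝ ∞ ρ := B.contDiff_normed
  have hρc : HasCompactSupport ρ := B.hasCompactSupport_normed
  have hρ1 : ∫ t, ρ t = 1 := B.integral_normed
  have hint : ∀ η : ℝ → ℝ, ContDiff ℝ ∞ η → HasCompactSupport η →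
      Integrable (fun t => η t • g t) := fun η h1 h2 =>
    hg.integrable_smul_left_of_hasCompactSupport h1.continuous h2
  -- The constant has to be the average of `g` against a bump of integral one: subtracting `m ρ`
  -- from a test function `χ` leaves mean zero.
  refine ⟨∫ t, ρ t • g t, ?_⟩
  set c := ∫ t, ρ t • g t with hc
  have hloc : LocallyIntegrable (fun t => g t - c) volume :=
    hg.sub (locallyIntegrable_const c)
  have key : ∀ᵐ t, g t - c = 0 := by
    apply ae_eq_zero_of_integral_contDiff_smul_eq_zero hloc
    intro χ hχ hχc
    have hχi : Integrable χ := hχ.continuous.integrable_of_hasCompactSupport hχc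
    have hρi : Integrable ρ := hρs.continuous.integrable_of_hasCompactSupport hρc
    set m := ∫ t, χ t with hm
    -- `χ - m ρ` is the derivative of a test function `Ψ`
    set θ : ℝ → ℝ := fun t => χ t - m * ρ t with hθ
    have hθs : ContDiff ℝ ∞ θ := hχ.sub (contDiff_const.mul hρs)
    have hθc : HasCompactSupport θ := hχc.sub (hρc.mul_left)
    have hθ0 : ∫ t, θ t = 0 := by
      rw [integral_sub hχi (hρi.const_mul m), integral_const_mul, hρ1, mul_one, sub_self]
    obtain ⟨R, hR⟩ := hθc.isCompact.isBounded.subset_closedBall 0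
    set b := |R| + 1 with hb
    have hθz : ∀ t, b ≤ |t| → θ t = 0 := by
      intro t ht
      refine image_eq_zero_of_notMem_tsupport fun h => ?_
      have := hR h
      rw [Metric.mem_closedBall, Real.dist_eq, sub_zero] at this
      linarith [le_abs_self R]
    have hb0 : 0 < b := by positivity
    set Ψ : ℝ → ℝ := fun t => ∫ u in (-b)..t, θ u with hΨ
    have hΨd : ∀ t, HasDerivAt Ψ (θ t) t := fun t =>
      (hθs.continuous.integral_hasStrictDerivAt (-b) t).hasDerivAt
    have hΨ' : deriv Ψ = θ := funext fun t => (hΨd t).deriv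
    have hΨs : ContDiff ℝ ∞ Ψ := by
      rw [contDiff_infty_iff_deriv, hΨ']
      exact ⟨fun t => (hΨd t).differentiableAt, hθs⟩
    have hfull : ∀ t, b ≤ t → ∫ u in (-b)..t, θ u = 0 := by
      intro t ht
      rw [intervalIntegral.integral_eq_integral_of_support_subset, hθ0]
      intro x hx
      by_contra hx'
      refine hx (hθz x ?_)
      rw [mem_Ioc, not_and_or, not_lt, not_le] at hx'
      rcases hx' with h' | h'
      · exact le_abs.2 (Or.inr (by linarith))
      · exact le_abs.2 (Or.inl (by linarith))
    have hΨc : HasCompactSupport Ψ := by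
      refine HasCompactSupport.intro (isCompact_Icc (a := -b) (b := b)) fun t ht => ?_
      rw [mem_Icc, not_and_or, not_le, not_le] at ht
      rcases ht with ht | ht
      · have : ∫ u in (-b)..t, θ u = ∫ u in (-b)..t, (0 : ℝ) := by
          refine intervalIntegral.integral_congr fun u hu => hθz u ?_
          rw [uIcc_of_ge ht.le] at hu
          exact le_abs.2 (Or.inr (by linarith [hu.2]))
        simpa [hΨ] using this
      · exact hfull t ht.le
    refine ext_inner_left ℝ fun x => ?_
    have e0 := h (fun t => Ψ t • x) (hΨs.smul contDiff_const) hΨc.smul_right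
    have e1 : ∀ t, deriv (fun t => Ψ t • x) t = θ t • x := fun t =>
      ((hΨd t).smul_const x).deriv
    simp only [e1] at e0
    have e2 : ∫ t, inner ℝ x (θ t • g t) = 0 := by
      rw [← e0]
      refine integral_congr_ae (.of_forall fun t => ?_)
      simp only [real_inner_smul_right]
      rw [real_inner_comm]
    rw [integral_inner (hint θ hθs hθc) x] at e2
    have e3 : ∫ t, θ t • g t = (∫ t, χ t • g t) - m • c := by
      have i2 : Integrable (fun t => m • ρ t • g t) := (hint ρ hρs hρc).smul m
      rw [hc, ← integral_smul, ← integral_sub (hint χ hχ hχc) i2]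
      refine integral_congr_ae (.of_forall fun t => ?_)
      simp [hθ, sub_smul, mul_smul]
    have e4 : ∫ t, χ t • (g t - c) = (∫ t, χ t • g t) - m • c := by
      simp only [smul_sub]
      rw [integral_sub (hint χ hχ hχc) (hχi.smul_const c), integral_smul_const]
    rw [e4, ← e3, e2, inner_zero_right]
  filter_upwards [key] with t ht
  exact sub_eq_zero.1 ht

/-- A function with a locally integrable weak derivative is almost everywhere equal to a
primitive of it. -/
theorem IsWeakDeriv.exists_ae_eq_primitive {H : Type*} [NormedAddCommGroup H]
    [InnerProductSpace ℝ H] [CompleteSpace H] {f v : ℝ → H} (hf : LocallyIntegrable f volume)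
    (hv : LocallyIntegrable v volume) (h : IsWeakDeriv f v) :
    ∃ c : H, f =ᵐ[volume] fun t => c + ∫ u in (0 : ℝ)..t, v u := by
  set F : ℝ → H := fun t => ∫ u in (0 : ℝ)..t, v u with hF
  have hFc : Continuous F := by simpa using continuous_add_primitive hv 0
  obtain ⟨c, hc⟩ := exists_ae_eq_const_of_integral_inner_deriv_eq_zero
    (g := fun t => f t - F t) (hf.sub hFc.locallyIntegrable) fun χ hχ hχc => by
      have hd : Continuous (deriv χ) := hχ.continuous_deriv (by simp)
      have i1 : Integrable fun t => inner ℝ (f t) (deriv χ t) := by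
        obtain ⟨M, hM⟩ := hχc.deriv.exists_bound_of_continuous hd
        have hio : IntegrableOn f (tsupport (deriv χ)) :=
          hf.integrableOn_isCompact hχc.deriv.isCompact
        have : IntegrableOn (fun t => inner ℝ (f t) (deriv χ t)) (tsupport (deriv χ)) := by
          refine (hio.norm.mul_const M).mono'
            (hio.aestronglyMeasurable.inner hd.aestronglyMeasurable) (.of_forall fun t => ?_)
          exact (norm_inner_le_norm _ _).trans (mul_le_mul_of_nonneg_left (hM t) (norm_nonneg _))
        rw [← integrableOn_iff_integrable_of_support_subset
          (s := tsupport (deriv χ))]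
        · exact this
        · intro t ht
          refine subset_tsupport _ fun h0 => ht ?_
          simp [h0]
      have i2 : Integrable fun t => inner ℝ (F t) (deriv χ t) := by
        refine (hFc.inner hd).integrable_of_hasCompactSupport ?_
        exact hχc.deriv.mono' fun t ht => subset_tsupport _ fun h0 => ht (by simp [h0])
      simp only [inner_sub_left]
      rw [integral_sub i1 i2, h χ hχ hχc, isWeakDeriv_primitive hv χ hχ hχc, sub_self]
  refine ⟨c, ?_⟩
  filter_upwards [hc] with t ht
  rw [← ht]
  abel

/-! ### The one-dimensional Sobolev inequality, in local form. -/

/-- Compare `f t` with `f s` and average over `s` in a unit interval. Keeping the right side local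
yields both the uniform bound and the decay at infinity. -/
theorem norm_sq_primitive_le {H : Type*} [NormedAddCommGroup H] [NormedSpace ℝ H]
    {f v : ℝ → H} (hv : MemLp v 2 volume) (hf : MemLp f 2 volume) (c : H)
    (hfv : ∀ t, f t = c + ∫ u in (0 : ℝ)..t, v u) (t : ℝ) :
    ‖f t‖ ^ 2 ≤ 2 * ∫ s in t..(t + 1), (‖f s‖ ^ 2 + ‖v s‖ ^ 2) := by
  have hvl : LocallyIntegrable v volume := hv.locallyIntegrable (by norm_num)
  have hvi : ∀ a b, IntervalIntegrable v volume a b := hvl.intervalIntegrable_real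
  have hf2 : Integrable fun s => ‖f s‖ ^ 2 := hf.integrable_norm_pow (by norm_num)
  have hv2 : Integrable fun s => ‖v s‖ ^ 2 := hv.integrable_norm_pow (by norm_num)
  set M := ∫ u in t..(t + 1), ‖v u‖ with hM
  set Q := ∫ u in t..(t + 1), ‖v u‖ ^ 2 with hQ
  -- Cauchy–Schwarz on an interval of length one, read off from the nonnegative variance of `‖v‖`.
  have hMQ : M ^ 2 ≤ Q := by
    have h0 : 0 ≤ ∫ u in t..(t + 1), (‖v u‖ - M) ^ 2 :=
      intervalIntegral.integral_nonneg (by linarith) fun _ _ => sq_nonneg _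
    have e : ∀ u, (‖v u‖ - M) ^ 2 = ‖v u‖ ^ 2 - 2 * M * ‖v u‖ + M ^ 2 := fun u => by ring
    simp only [e] at h0
    rw [intervalIntegral.integral_add (hv2.intervalIntegrable.sub
        ((hvi _ _).norm.const_mul _)) intervalIntegrable_const,
      intervalIntegral.integral_sub hv2.intervalIntegrable ((hvi _ _).norm.const_mul _),
      intervalIntegral.integral_const_mul, intervalIntegral.integral_const] at h0
    simp only [add_sub_cancel_left, one_smul, ← hM, ← hQ] at h0
    nlinarith
  have hpt : ∀ s ∈ Icc t (t + 1), ‖f t‖ ^ 2 ≤ 2 * ‖f s‖ ^ 2 + 2 * Q := by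
    intro s hs
    have e : f t = f s - ∫ u in t..s, v u := by
      rw [hfv t, hfv s, ← intervalIntegral.integral_interval_sub_left (hvi 0 s) (hvi 0 t)]
      abel
    have h1 : ‖∫ u in t..s, v u‖ ≤ M :=
      (intervalIntegral.norm_integral_le_integral_norm hs.1).trans
        (intervalIntegral.integral_mono_interval le_rfl hs.1 hs.2
          (.of_forall fun _ => norm_nonneg _) (hvi _ _).norm)
    have h2 : ‖f t‖ ≤ ‖f s‖ + M := by
      rw [e]
      exact (norm_sub_le _ _).trans (add_le_add_right h1 _)
    have h3 : ‖f t‖ ^ 2 ≤ (‖f s‖ + M) ^ 2 := pow_le_pow_left₀ (norm_nonneg _) h2 2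
    nlinarith [sq_nonneg (‖f s‖ - M)]
  have hI := intervalIntegral.integral_mono_on (μ := volume) (a := t) (b := t + 1) (by linarith)
    (f := fun _ => ‖f t‖ ^ 2) (g := fun s => 2 * ‖f s‖ ^ 2 + 2 * Q) intervalIntegrable_const
    ((hf2.const_mul 2).intervalIntegrable.add intervalIntegrable_const) hpt
  rw [intervalIntegral.integral_add (hf2.const_mul 2).intervalIntegrable intervalIntegrable_const,
    intervalIntegral.integral_const_mul, intervalIntegral.integral_const,
    intervalIntegral.integral_const] at hI
  rw [intervalIntegral.integral_add hf2.intervalIntegrable hv2.intervalIntegrable]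
  simp only [add_sub_cancel_left, one_smul] at hI
  linarith

/-- The integral is a difference of two values of a primitive that converges at both ends. -/
theorem tendsto_integral_unit_interval {w : ℝ → ℝ} (hw : Integrable w volume) :
    Filter.Tendsto (fun t => ∫ s in t..(t + 1), w s) (Filter.cocompact ℝ) (nhds 0) := by
  have e : ∀ t, ∫ s in t..(t + 1), w s =
      (∫ s in (0 : ℝ)..(t + 1), w s) - ∫ s in (0 : ℝ)..t, w s := fun t =>
    (intervalIntegral.integral_interval_sub_left hw.intervalIntegrable hw.intervalIntegrable).symm
  simp only [e]
  rw [cocompact_eq_atBot_atTop]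
  refine Filter.Tendsto.sup ?_ ?_
  · have h : Filter.Tendsto (fun t => ∫ s in t..(0 : ℝ), w s) Filter.atBot
        (nhds (∫ s in Iic 0, w s)) :=
      intervalIntegral_tendsto_integral_Iic 0 hw.integrableOn Filter.tendsto_id
    have h' := (h.comp (Filter.tendsto_atBot_add_const_right _ (1 : ℝ) Filter.tendsto_id)).neg.sub
      h.neg
    rw [sub_self] at h'
    refine h'.congr fun t => ?_
    simp only [Function.comp, id]
    rw [← intervalIntegral.integral_symm, ← intervalIntegral.integral_symm]
  · have h : Filter.Tendsto (fun t => ∫ s in (0 : ℝ)..t, w s) Filter.atTop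
        (nhds (∫ s in Ioi 0, w s)) :=
      intervalIntegral_tendsto_integral_Ioi 0 hw.integrableOn Filter.tendsto_id
    have h' := (h.comp (Filter.tendsto_atTop_add_const_right _ (1 : ℝ) Filter.tendsto_id)).sub h
    rwa [sub_self] at h'

theorem MeasureTheory.Lp.norm_sq_eq_integral {H : Type*} [NormedAddCommGroup H]
    [InnerProductSpace ℝ H] (u : Lp H 2 (volume : Measure ℝ)) :
    ‖u‖ ^ 2 = ∫ s, ‖u s‖ ^ 2 := by
  rw [← real_inner_self_eq_norm_sq, L2.inner_def]
  simp only [real_inner_self_eq_norm_sq]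

theorem norm_pathOf_le {H₁ H₂ : Type*} [NormedAddCommGroup H₁] [InnerProductSpace ℝ H₁]
    [NormedAddCommGroup H₂] [InnerProductSpace ℝ H₂] {ι : H₂ →L[ℝ] H₁} (ξ : pathSpace ι) : ‖pathOf ξ‖ ≤ ‖ξ‖ := by
  have h := WithLp.prod_norm_sq_eq_of_L2 ξ.1
  refine le_of_sq_le_sq ?_ (norm_nonneg _)
  change ‖ξ.1.fst‖ ^ 2 ≤ ‖ξ.1‖ ^ 2
  nlinarith [sq_nonneg ‖ξ.1.snd‖]

/-! ### Continuous representatives, the Sobolev embedding and openness of the domain. -/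

section PathSpace

variable {H₁ H₂ : Type*} [NormedAddCommGroup H₁] [InnerProductSpace ℝ H₁] [CompleteSpace H₁]
  [NormedAddCommGroup H₂] [InnerProductSpace ℝ H₂] {ι : H₂ →L[ℝ] H₁}

theorem exists_primitive_ae_eq (ξ : pathSpace ι) : ∃ c : H₁,
    (fun t => c + ∫ u in (0 : ℝ)..t, ξ.1.snd u) =ᵐ[volume] fun s => ι (pathOf ξ s) := by
  obtain ⟨c, hc⟩ := IsWeakDeriv.exists_ae_eq_primitive
    ((ι.comp_memLp' (Lp.memLp ξ.1.fst)).locallyIntegrable (by norm_num))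
    ((Lp.memLp ξ.1.snd).locallyIntegrable (by norm_num)) ξ.2
  exact ⟨c, hc.symm⟩

/-- The continuous representative of a path. -/
noncomputable def contRep (ξ : pathSpace ι) : ℝ → H₁ :=
  fun t => (exists_primitive_ae_eq ξ).choose + ∫ u in (0 : ℝ)..t, ξ.1.snd u

theorem contRep_ae_eq (ξ : pathSpace ι) : contRep ξ =ᵐ[volume] fun s => ι (pathOf ξ s) :=
  (exists_primitive_ae_eq ξ).choose_spec

theorem continuous_contRep (ξ : pathSpace ι) : Continuous (contRep ξ) :=
  continuous_add_primitive ((Lp.memLp ξ.1.snd).locallyIntegrable (by norm_num)) _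

theorem memLp_contRep (ξ : pathSpace ι) : MemLp (contRep ξ) 2 volume :=
  (memLp_congr_ae (contRep_ae_eq ξ)).2 (ι.comp_memLp' (Lp.memLp (pathOf ξ)))

theorem norm_sq_contRep_le (ξ : pathSpace ι) (t : ℝ) :
    ‖contRep ξ t‖ ^ 2 ≤ 2 * ∫ s in t..(t + 1), (‖contRep ξ s‖ ^ 2 + ‖ξ.1.snd s‖ ^ 2) :=
  norm_sq_primitive_le (Lp.memLp ξ.1.snd) (memLp_contRep ξ) _ (fun _ => rfl) t

theorem integrable_norm_sq_contRep_add (ξ : pathSpace ι) :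
    Integrable fun s => ‖contRep ξ s‖ ^ 2 + ‖ξ.1.snd s‖ ^ 2 :=
  ((memLp_contRep ξ).integrable_norm_pow (by norm_num)).add
    ((Lp.memLp ξ.1.snd).integrable_norm_pow (by norm_num))

theorem norm_contRep_le (hι : ∀ x : H₂, ‖ι x‖ ≤ ‖x‖) (ξ : pathSpace ι) (t : ℝ) :
    ‖contRep ξ t‖ ≤ 2 * ‖ξ‖ := by
  have h1 := norm_sq_contRep_le ξ t
  have h2 : ∫ s in t..(t + 1), (‖contRep ξ s‖ ^ 2 + ‖ξ.1.snd s‖ ^ 2) ≤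
      ∫ s, (‖contRep ξ s‖ ^ 2 + ‖ξ.1.snd s‖ ^ 2) := by
    rw [intervalIntegral.integral_of_le (by linarith)]
    exact setIntegral_le_integral (integrable_norm_sq_contRep_add ξ)
      (.of_forall fun s => add_nonneg (sq_nonneg _) (sq_nonneg _))
  have i1 : Integrable fun s => ‖pathOf ξ s‖ ^ 2 :=
    (Lp.memLp (pathOf ξ)).integrable_norm_pow (by norm_num)
  have i2 : Integrable fun s => ‖ξ.1.snd s‖ ^ 2 :=
    (Lp.memLp ξ.1.snd).integrable_norm_pow (by norm_num)
  have h3 : ∫ s, (‖contRep ξ s‖ ^ 2 + ‖ξ.1.snd s‖ ^ 2) ≤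
      ∫ s, (‖pathOf ξ s‖ ^ 2 + ‖ξ.1.snd s‖ ^ 2) := by
    refine integral_mono_ae (integrable_norm_sq_contRep_add ξ) (i1.add i2) ?_
    filter_upwards [contRep_ae_eq ξ] with s hs
    rw [hs]
    have := pow_le_pow_left₀ (norm_nonneg _) (hι (pathOf ξ s)) 2
    linarith
  rw [integral_add i1 i2, ← Lp.norm_sq_eq_integral, ← Lp.norm_sq_eq_integral] at h3
  have h4 : ‖ξ‖ ^ 2 = ‖pathOf ξ‖ ^ 2 + ‖ξ.1.snd‖ ^ 2 := WithLp.prod_norm_sq_eq_of_L2 ξ.1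
  -- The estimates give the constant `√2`; it is rounded up to `2`.
  refine le_of_sq_le_sq ?_ (by positivity)
  nlinarith [sq_nonneg ‖ξ‖]

theorem tendsto_contRep (ξ : pathSpace ι) :
    Filter.Tendsto (contRep ξ) (Filter.cocompact ℝ) (nhds 0) := by
  have h := (tendsto_integral_unit_interval (integrable_norm_sq_contRep_add ξ)).const_mul 2
  rw [mul_zero] at h
  have h1 := squeeze_zero (fun t => sq_nonneg ‖contRep ξ t‖) (norm_sq_contRep_le ξ) h
  have h2 := h1.sqrt
  simp only [Real.sqrt_zero, Real.sqrt_sq (norm_nonneg _)] at h2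
  exact tendsto_zero_iff_norm_tendsto_zero.2 h2

/-- Every later uniformity in `s` rests on this set, which lies in `U₁` precisely because `0` does.
-/
theorem isCompact_insert_range_contRep (ξ : pathSpace ι) :
    IsCompact (insert 0 (range (contRep ξ))) :=
  (tendsto_contRep ξ).isCompact_insert_range_of_cocompact (continuous_contRep ξ)

/-- The integration constant in `contRep` was chosen arbitrarily; continuity pins it down, which
makes linearity in the path provable. -/
theorem contRep_eq_of_ae_eq (ξ : pathSpace ι) {f : ℝ → H₁} (hf : Continuous f)
    (h : f =ᵐ[volume] fun s => ι (pathOf ξ s)) : contRep ξ = f :=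
  ((continuous_contRep ξ).ae_eq_iff_eq volume hf).1 ((contRep_ae_eq ξ).trans h.symm)

theorem contRep_add (ξ ζ : pathSpace ι) : contRep (ξ + ζ) = contRep ξ + contRep ζ := by
  refine contRep_eq_of_ae_eq _ ((continuous_contRep ξ).add (continuous_contRep ζ)) ?_
  filter_upwards [contRep_ae_eq ξ, contRep_ae_eq ζ, Lp.coeFn_add (pathOf ξ) (pathOf ζ)]
    with s h1 h2 h3
  have h4 : pathOf (ξ + ζ) s = pathOf ξ s + pathOf ζ s := h3
  rw [h4, Pi.add_apply, h1, h2, map_add]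

theorem contRep_smul (c : ℝ) (ξ : pathSpace ι) : contRep (c • ξ) = c • contRep ξ := by
  refine contRep_eq_of_ae_eq _ ((continuous_contRep ξ).const_smul c) ?_
  filter_upwards [contRep_ae_eq ξ, Lp.coeFn_smul c (pathOf ξ)] with s h1 h3
  have h4 : pathOf (c • ξ) s = c • pathOf ξ s := h3
  rw [h4, Pi.smul_apply, h1, map_smul]

/-- The Sobolev embedding of the path space into the bounded continuous `H₁`-valued functions. -/
noncomputable def sobolevEmb (ι : H₂ →L[ℝ] H₁) (hι : ∀ x : H₂, ‖ι x‖ ≤ ‖x‖) :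
    pathSpace ι →L[ℝ] BoundedContinuousFunction ℝ H₁ :=
  LinearMap.mkContinuous
    { toFun := fun ξ => BoundedContinuousFunction.ofNormedAddCommGroup (contRep ξ)
        (continuous_contRep ξ) (2 * ‖ξ‖) (norm_contRep_le hι ξ)
      map_add' := fun ξ ζ => by
        ext s
        simp [contRep_add]
      map_smul' := fun c ξ => by
        ext s
        simp [contRep_smul] }
    2 fun ξ => BoundedContinuousFunction.norm_ofNormedAddCommGroup_le _ (by positivity)
      (norm_contRep_le hι ξ)

theorem mem_pathDomain_iff {U : Set H₁} {ξ : pathSpace ι} :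
    ξ ∈ pathDomain ι U ↔ ∀ s, contRep ξ s ∈ U := by
  constructor
  · rintro ⟨f, hf, hfe, hfU⟩ s
    rw [contRep_eq_of_ae_eq ξ hf hfe]
    exact hfU s
  · exact fun h => ⟨_, continuous_contRep ξ, contRep_ae_eq ξ, h⟩

theorem insert_range_contRep_subset {U : Set H₁} (h0 : (0 : H₁) ∈ U) {ξ : pathSpace ι}
    (hξ : ξ ∈ pathDomain ι U) : insert 0 (range (contRep ξ)) ⊆ U := by
  rintro x (rfl | ⟨s, rfl⟩)
  · exact h0
  · exact mem_pathDomain_iff.1 hξ s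

theorem norm_contRep_sub_le (hι : ∀ x : H₂, ‖ι x‖ ≤ ‖x‖) (ξ ζ : pathSpace ι) (t : ℝ) :
    ‖contRep ξ t - contRep ζ t‖ ≤ 2 * ‖ξ - ζ‖ := by
  have := norm_contRep_le hι (ξ - ζ) t
  have e : contRep (ξ - ζ) t = contRep ξ t - contRep ζ t :=
    congrArg (fun f => f t) (map_sub (sobolevEmb ι hι) ξ ζ)
  rwa [e] at this

theorem isOpen_pathDomain (hι : ∀ x : H₂, ‖ι x‖ ≤ ‖x‖) {U : Set H₁} (hU : IsOpen U)
    (h0 : (0 : H₁) ∈ U) : IsOpen (pathDomain ι U) := by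
  rw [Metric.isOpen_iff]
  intro ξ hξ
  obtain ⟨δ, hδ, h⟩ := (isCompact_insert_range_contRep ξ).exists_thickening_subset_open hU
    (insert_range_contRep_subset h0 hξ)
  -- The radius is halved because the embedding has norm at most `2`.
  refine ⟨δ / 2, by positivity, fun ζ hζ => mem_pathDomain_iff.2 fun s => h ?_⟩
  rw [Metric.mem_thickening_iff]
  refine ⟨contRep ξ s, mem_insert_of_mem _ (mem_range_self s), ?_⟩
  rw [dist_eq_norm]
  have := norm_contRep_sub_le hι ζ ξ s
  rw [Metric.mem_ball, dist_eq_norm] at hζ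
  linarith

end PathSpace

/-! ### Superposition on bounded continuous functions. -/

/-- Stronger than uniform continuity on `K`: the second point may leave `K`, as values of nearby
paths do. -/
theorem IsCompact.exists_forall_dist_lt {X Y : Type*} [PseudoMetricSpace X]
    [PseudoMetricSpace Y] {K : Set X} (hK : IsCompact K) {g : X → Y}
    (hg : ∀ x ∈ K, ContinuousAt g x) {ε : ℝ} (hε : 0 < ε) :
    ∃ δ > 0, ∀ x ∈ K, ∀ y, dist x y < δ → dist (g x) (g y) < ε := by
  have := hK.uniformContinuousAt_of_continuousAt g hg (Metric.dist_mem_uniformity hε)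
  obtain ⟨δ, hδ, h⟩ := Metric.mem_uniformity_dist.1 this
  exact ⟨δ, hδ, fun x hx y hxy => h hxy hx⟩

namespace BoundedContinuousFunction

variable {α H F : Type*} [TopologicalSpace α] [NormedAddCommGroup H] [NormedAddCommGroup F]

open Classical in
/-- The superposition operator `f ↦ g ∘ f`, with value `0` where `g ∘ f` is not bounded and
continuous. -/
noncomputable def superpose (g : H → F) (f : BoundedContinuousFunction α H) :
    BoundedContinuousFunction α F :=
  if h : Continuous (fun s => g (f s)) ∧ ∃ C, ∀ s, ‖g (f s)‖ ≤ C then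
    ofNormedAddCommGroup (fun s => g (f s)) h.1 h.2.choose h.2.choose_spec
  else 0

theorem superpose_apply {g : H → F} {f : BoundedContinuousFunction α H}
    (hc : Continuous fun s => g (f s)) {C : ℝ} (hC : ∀ s, ‖g (f s)‖ ≤ C) (s : α) :
    superpose g f s = g (f s) := by
  rw [superpose, dif_pos ⟨hc, C, hC⟩]
  rfl

variable {U K : Set H} {g : H → F} {f : BoundedContinuousFunction α H}

/-- Near `f` the default value is never taken: `f'` stays in a thickening of `K` inside `U`, and `g
∘ f'` stays within `1` of the bounded function `g ∘ f`. -/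
theorem eventually_superpose_apply (hU : IsOpen U) (hg : ContinuousOn g U) (hK : IsCompact K)
    (hKU : K ⊆ U) (hf : ∀ s, f s ∈ K) :
    ∀ᶠ f' in nhds f, ∀ s, superpose g f' s = g (f' s) := by
  obtain ⟨δ, hδ, h⟩ := hK.exists_forall_dist_lt
    (fun x hx => hg.continuousAt (hU.mem_nhds (hKU hx))) one_pos
  obtain ⟨r, hr, hrU⟩ := hK.exists_thickening_subset_open hU hKU
  obtain ⟨M, hM⟩ := hK.exists_bound_of_continuousOn (hg.mono hKU)
  filter_upwards [Metric.ball_mem_nhds f (lt_min hδ hr)] with f' hf'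
  have hd : ∀ s, dist (f s) (f' s) < min δ r := fun s => by
    rw [dist_comm]
    exact (dist_coe_le_dist s).trans_lt hf'
  refine superpose_apply (C := M + 1) (hg.comp_continuous f'.continuous fun s => hrU ?_)
    fun s => ?_
  · rw [Metric.mem_thickening_iff]
    exact ⟨f s, hf s, by rw [dist_comm]; exact (hd s).trans_le (min_le_right _ _)⟩
  · have h1 := h _ (hf s) _ ((hd s).trans_le (min_le_left _ _))
    rw [dist_comm, dist_eq_norm] at h1
    have h2 := hM _ (hf s)
    have h3 := norm_add_le (g (f' s) - g (f s)) (g (f s))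
    rw [sub_add_cancel] at h3
    linarith

theorem continuousAt_superpose (hU : IsOpen U) (hg : ContinuousOn g U) (hK : IsCompact K)
    (hKU : K ⊆ U) (hf : ∀ s, f s ∈ K) : ContinuousAt (superpose g) f := by
  have hev := eventually_superpose_apply hU hg hK hKU hf
  rw [Metric.continuousAt_iff']
  intro ε hε
  obtain ⟨δ, hδ, h⟩ := hK.exists_forall_dist_lt
    (fun x hx => hg.continuousAt (hU.mem_nhds (hKU hx))) (half_pos hε)
  filter_upwards [hev, Metric.ball_mem_nhds f hδ] with f' h1 h2
  refine lt_of_le_of_lt ((dist_le (half_pos hε).le).2 fun s => ?_) (half_lt_self hε)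
  rw [h1, hev.self_of_nhds, dist_comm]
  refine (h _ (hf s) _ ?_).le
  rw [dist_comm]
  exact (dist_coe_le_dist s).trans_lt h2

variable [NormedSpace ℝ H] [NormedSpace ℝ F]

theorem norm_apply_le (T : BoundedContinuousFunction α (H →L[ℝ] F))
    (f : BoundedContinuousFunction α H) (s : α) : ‖T s (f s)‖ ≤ ‖T‖ * ‖f‖ :=
  (T s).le_of_opNorm_le_of_le (T.norm_coe_le_norm s) (f.norm_coe_le_norm s)

/-- Pointwise application of operator-valued functions. -/
noncomputable def applyL :
    BoundedContinuousFunction α (H →L[ℝ] F) →L[ℝ]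
      BoundedContinuousFunction α H →L[ℝ] BoundedContinuousFunction α F :=
  LinearMap.mkContinuous₂
    (LinearMap.mk₂ ℝ
      (fun (T : BoundedContinuousFunction α (H →L[ℝ] F)) (f : BoundedContinuousFunction α H) =>
        ofNormedAddCommGroup (fun s => T s (f s)) (T.continuous.clm_apply f.continuous)
          (‖T‖ * ‖f‖) (norm_apply_le T f))
      (fun _ _ _ => by ext; simp) (fun _ _ _ => by ext; simp)
      (fun _ _ _ => by ext; simp) (fun _ _ _ => by ext; simp))
    1 fun T f => by
      rw [one_mul]
      exact norm_ofNormedAddCommGroup_le _ (by positivity) (norm_apply_le T f)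

@[simp]
theorem applyL_apply (T : BoundedContinuousFunction α (H →L[ℝ] F))
    (f : BoundedContinuousFunction α H) (s : α) : applyL T f s = T s (f s) := rfl

/-- The mean value inequality is applied on the ball around each `f s`, whose radius does not depend
on `s` and on which `fderiv ℝ g` varies by at most `ε`. -/
theorem hasFDerivAt_superpose (hU : IsOpen U) (hg : ContDiffOn ℝ 1 g U) (hK : IsCompact K)
    (hKU : K ⊆ U) (hf : ∀ s, f s ∈ K) :
    HasFDerivAt (superpose g) (applyL (superpose (fderiv ℝ g) f)) f := by
  have hg' : ContinuousOn (fderiv ℝ g) U := hg.continuousOn_fderiv_of_isOpen hU le_rfl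
  have ev := eventually_superpose_apply hU hg.continuousOn hK hKU hf
  have ev' := (eventually_superpose_apply hU hg' hK hKU hf).self_of_nhds
  rw [hasFDerivAt_iff_isLittleO, Asymptotics.isLittleO_iff]
  intro ε hε
  obtain ⟨δ, hδ, h⟩ := hK.exists_forall_dist_lt
    (fun x hx => hg'.continuousAt (hU.mem_nhds (hKU hx))) hε
  obtain ⟨r, hr, hrU⟩ := hK.exists_thickening_subset_open hU hKU
  filter_upwards [ev, Metric.ball_mem_nhds f (lt_min hδ hr)] with f' h1 h2
  refine (norm_le (by positivity)).2 fun s => ?_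
  have hball : ∀ y ∈ Metric.ball (f s) (min δ r), HasFDerivWithinAt g (fderiv ℝ g y)
      (Metric.ball (f s) (min δ r)) y := by
    intro y hy
    have hyU : y ∈ U := hrU (Metric.mem_thickening_iff.2
      ⟨f s, hf s, (Metric.mem_ball.1 hy).trans_le (min_le_right _ _)⟩)
    exact (((hg.contDiffAt (hU.mem_nhds hyU)).differentiableAt
      (by simp)).hasFDerivAt).hasFDerivWithinAt
  have hs : f' s ∈ Metric.ball (f s) (min δ r) := (dist_coe_le_dist s).trans_lt h2
  have key := (convex_ball (f s) (min δ r)).norm_image_sub_le_of_norm_hasFDerivWithin_le'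
    (φ := fderiv ℝ g (f s)) (C := ε) hball (fun y hy => by
      rw [← dist_eq_norm, dist_comm]
      refine (h _ (hf s) _ ?_).le
      rw [dist_comm]
      exact (Metric.mem_ball.1 hy).trans_le (min_le_left _ _))
    (Metric.mem_ball_self (lt_min hδ hr)) hs
  simp only [coe_sub, Pi.sub_apply, applyL_apply, h1, ev.self_of_nhds, ev']
  refine key.trans (mul_le_mul_of_nonneg_left ?_ hε.le)
  exact (f' - f).norm_coe_le_norm s

end BoundedContinuousFunction

/-! ### Multiplication operators on `L²`. -/

section Multiplication

variable {F G : Type*} [NormedAddCommGroup F] [NormedSpace ℝ F] [NormedAddCommGroup G]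
  [NormedSpace ℝ G]

theorem ae_norm_apply_le (T : BoundedContinuousFunction ℝ (F →L[ℝ] G)) (u : ℝ → F) :
    ∀ᵐ s : ℝ, ‖T s (u s)‖ ≤ ‖T‖ * ‖u s‖ :=
  .of_forall fun s => (T s).le_of_opNorm_le (T.norm_coe_le_norm s) _

theorem memLp_apply (T : BoundedContinuousFunction ℝ (F →L[ℝ] G))
    (u : Lp F 2 (volume : Measure ℝ)) : MemLp (fun s => T s (u s)) 2 (volume : Measure ℝ) :=
  (Lp.memLp u).of_le_mul
    (isBoundedBilinearMap_apply.continuous.comp_aestronglyMeasurable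
      (T.continuous.aestronglyMeasurable.prodMk (Lp.aestronglyMeasurable u)))
    (ae_norm_apply_le T u)

/-- Multiplication of an `L²` function by a bounded continuous operator-valued function. -/
noncomputable def mulLp : BoundedContinuousFunction ℝ (F →L[ℝ] G) →L[ℝ]
    Lp F 2 (volume : Measure ℝ) →L[ℝ] Lp G 2 (volume : Measure ℝ) :=
  LinearMap.mkContinuous₂
    (LinearMap.mk₂ ℝ (fun (T : BoundedContinuousFunction ℝ (F →L[ℝ] G))
        (u : Lp F 2 (volume : Measure ℝ)) => (memLp_apply T u).toLp _)
      (fun S T u => by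
        rw [← MemLp.toLp_add]
        exact MemLp.toLp_congr _ _ (.of_forall fun s => by simp))
      (fun c T u => by
        rw [← MemLp.toLp_const_smul]
        exact MemLp.toLp_congr _ _ (.of_forall fun s => by simp))
      (fun T u v => by
        rw [← MemLp.toLp_add]
        refine MemLp.toLp_congr _ _ ?_
        filter_upwards [Lp.coeFn_add u v] with s hs
        rw [hs, Pi.add_apply, Pi.add_apply, map_add])
      (fun c T u => by
        rw [← MemLp.toLp_const_smul]
        refine MemLp.toLp_congr _ _ ?_
        filter_upwards [Lp.coeFn_smul c u] with s hs
        rw [hs, Pi.smul_apply, Pi.smul_apply, map_smul]))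
    1 fun T u => by
      rw [one_mul]
      refine Lp.norm_le_mul_norm_of_ae_le_mul ?_
      filter_upwards [(memLp_apply T u).coeFn_toLp, ae_norm_apply_le T u] with s h1 h2
      simp only [LinearMap.mk₂_apply]
      rwa [h1]

theorem mulLp_ae_eq (T : BoundedContinuousFunction ℝ (F →L[ℝ] G))
    (u : Lp F 2 (volume : Measure ℝ)) : ∀ᵐ s, mulLp T u s = T s (u s) :=
  (memLp_apply T u).coeFn_toLp

end Multiplication

theorem contDiffOn_one_of_hasFDerivAt {E F : Type*} [NormedAddCommGroup E] [NormedSpace ℝ E]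
    [NormedAddCommGroup F] [NormedSpace ℝ F] {f : E → F} {f' : E → E →L[ℝ] F} {U : Set E}
    (hU : IsOpen U) (hf : ∀ x ∈ U, HasFDerivAt f (f' x) x) (hc : ContinuousOn f' U) :
    ContDiffOn ℝ 1 f U := by
  rw [← zero_add (1 : WithTop ℕ∞), contDiffOn_succ_iff_fderiv_of_isOpen hU]
  refine ⟨fun x hx => (hf x hx).differentiableAt.differentiableWithinAt, by simp, ?_⟩
  rw [contDiffOn_zero]
  exact hc.congr fun x hx => (hf x hx).fderiv

/-! ### Differentiable dependence of multiplication operators on the path. -/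

section PathSpace

open BoundedContinuousFunction

variable {H₁ H₂ F G : Type*} [NormedAddCommGroup H₁] [InnerProductSpace ℝ H₁] [CompleteSpace H₁]
  [NormedAddCommGroup H₂] [InnerProductSpace ℝ H₂] {ι : H₂ →L[ℝ] H₁}
  [NormedAddCommGroup F] [NormedSpace ℝ F] [NormedAddCommGroup G] [NormedSpace ℝ G]

theorem contDiffOn_superpose_sobolevEmb (hι : ∀ x : H₂, ‖ι x‖ ≤ ‖x‖) {U : Set H₁}
    (hU : IsOpen U) (h0 : (0 : H₁) ∈ U) {g : H₁ → F} (hg : ContDiffOn ℝ 1 g U) :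
    ContDiffOn ℝ 1 (fun ξ : pathSpace ι => superpose g (sobolevEmb ι hι ξ))
      (pathDomain ι U) := by
  have hg' : ContinuousOn (fderiv ℝ g) U := hg.continuousOn_fderiv_of_isOpen hU le_rfl
  refine contDiffOn_one_of_hasFDerivAt (isOpen_pathDomain hι hU h0)
    (f' := fun ξ => (applyL (superpose (fderiv ℝ g) (sobolevEmb ι hι ξ))).comp (sobolevEmb ι hι))
    (fun ξ hξ => ?_) fun ξ hξ => ContinuousAt.continuousWithinAt ?_
  · exact (hasFDerivAt_superpose hU hg (isCompact_insert_range_contRep ξ)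
      (insert_range_contRep_subset h0 hξ)
      fun s => mem_insert_of_mem _ (mem_range_self s)).comp ξ (sobolevEmb ι hι).hasFDerivAt
  · have h1 : ContinuousAt (superpose (fderiv ℝ g)) (sobolevEmb ι hι ξ) :=
      continuousAt_superpose hU hg' (isCompact_insert_range_contRep ξ)
        (insert_range_contRep_subset h0 hξ) fun s => mem_insert_of_mem _ (mem_range_self s)
    have h2 : ContinuousAt (fun ξ => superpose (fderiv ℝ g) (sobolevEmb ι hι ξ)) ξ :=
      ContinuousAt.comp (f := sobolevEmb ι hι) h1 (sobolevEmb ι hι).continuous.continuousAt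
    exact (applyL.continuous.continuousAt.comp h2).clm_comp continuousAt_const

theorem superpose_sobolevEmb_apply {F : Type*} [NormedAddCommGroup F] (hι : ∀ x : H₂, ‖ι x‖ ≤ ‖x‖) {U : Set H₁}
    (hU : IsOpen U) (h0 : (0 : H₁) ∈ U) {g : H₁ → F} (hg : ContinuousOn g U) {ξ : pathSpace ι}
    (hξ : ξ ∈ pathDomain ι U) (s : ℝ) :
    superpose g (sobolevEmb ι hι ξ) s = g (contRep ξ s) :=
  (eventually_superpose_apply hU hg (isCompact_insert_range_contRep ξ)
    (insert_range_contRep_subset h0 hξ)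
    fun s => mem_insert_of_mem _ (mem_range_self s)).self_of_nhds s

/-- `mulLp` is bounded bilinear, so only the coefficient is differentiated, and that happens in the
sup norm. -/
theorem contDiffOn_mulLp_superpose (hι : ∀ x : H₂, ‖ι x‖ ≤ ‖x‖) {U : Set H₁}
    (hU : IsOpen U) (h0 : (0 : H₁) ∈ U) {g : H₁ → F →L[ℝ] G} (hg : ContDiffOn ℝ 1 g U) :
    ContDiffOn ℝ 1 (fun p : pathSpace ι × Lp F 2 (volume : Measure ℝ) =>
      mulLp (superpose g (sobolevEmb ι hι p.1)) p.2) (pathDomain ι U ×ˢ univ) := by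
  have h1 : ContDiffOn ℝ 1 (fun p : pathSpace ι × Lp F 2 (volume : Measure ℝ) =>
      superpose g (sobolevEmb ι hι p.1)) (pathDomain ι U ×ˢ univ) :=
    (contDiffOn_superpose_sobolevEmb hι hU h0 hg).comp contDiff_fst.contDiffOn fun p hp => hp.1
  exact (mulLp.contDiff.comp_contDiffOn h1).clm_apply contDiff_snd.contDiffOn

end PathSpace

/-! ### Pointwise consequences of the taming estimate. -/

section Tame

variable {H₁ H₂ : Type*} [NormedAddCommGroup H₁] [InnerProductSpace ℝ H₁]
  [NormedAddCommGroup H₂] [InnerProductSpace ℝ H₂] {ι : H₂ →L[ℝ] H₁}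

/-- The taming estimate for the second derivative of `ψ`, with a constant `κ`, at all points
of the preimage of `W`. -/
def TameOn (ι : H₂ →L[ℝ] H₁) (ψ : H₂ → H₂) (κ : ℝ) (W : Set H₁) : Prop :=
  ∀ y : H₂, ι y ∈ W → ∀ ξ η : H₂,
    ‖fderiv ℝ (fderiv ℝ ψ) y ξ η‖ ≤
      κ * (‖ι ξ‖ * ‖η‖ + ‖ξ‖ * ‖ι η‖ + ‖y‖ * ‖ι ξ‖ * ‖ι η‖)

theorem TameOn.mono {ψ : H₂ → H₂} {κ κ' : ℝ} {W W' : Set H₁} (h : TameOn ι ψ κ W)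
    (hκ : κ ≤ κ') (hW : W' ⊆ W) : TameOn ι ψ κ' W' := fun y hy ξ η =>
  (h y (hW hy) ξ η).trans (mul_le_mul_of_nonneg_right hκ (by positivity))

theorem exists_tameOn_thickening {ψ : H₂ → H₂} {U K : Set H₁}
    (h : ∀ x ∈ U, ∃ W : Set H₁, IsOpen W ∧ x ∈ W ∧ W ⊆ U ∧ ∃ κ : ℝ, 0 < κ ∧ TameOn ι ψ κ W)
    (hK : IsCompact K) (hKU : K ⊆ U) :
    ∃ r > 0, Metric.thickening r K ⊆ U ∧ ∃ κ > 0, TameOn ι ψ κ (Metric.thickening r K) := by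
  have : ∃ W : Set H₁, IsOpen W ∧ K ⊆ W ∧ W ⊆ U ∧ ∃ κ : ℝ, 0 < κ ∧ TameOn ι ψ κ W := by
    refine hK.induction_on
      (p := fun S => ∃ W : Set H₁, IsOpen W ∧ S ⊆ W ∧ W ⊆ U ∧ ∃ κ : ℝ, 0 < κ ∧ TameOn ι ψ κ W)
      ?_ ?_ ?_ ?_
    · exact ⟨∅, isOpen_empty, le_rfl, empty_subset _, 1, one_pos, fun y hy => hy.elim⟩
    · rintro S T hST ⟨W, h1, h2, h3⟩
      exact ⟨W, h1, hST.trans h2, h3⟩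
    · rintro S T ⟨W, h1, h2, h3, κ, h4, h5⟩ ⟨W', h1', h2', h3', κ', h4', h5'⟩
      refine ⟨W ∪ W', h1.union h1', union_subset_union h2 h2', union_subset h3 h3',
        max κ κ', lt_max_of_lt_left h4, fun y hy => ?_⟩
      rcases hy with hy | hy
      · exact h5.mono (le_max_left _ _) le_rfl y hy
      · exact h5'.mono (le_max_right _ _) le_rfl y hy
    · intro x hx
      obtain ⟨W, h1, h2, h3⟩ := h x (hKU hx)
      exact ⟨W, mem_nhdsWithin_of_mem_nhds (h1.mem_nhds h2), W, h1, le_rfl, h3⟩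
  obtain ⟨W, h1, h2, h3, κ, h4, h5⟩ := this
  obtain ⟨r, hr, hrW⟩ := hK.exists_thickening_subset_open h1 h2
  exact ⟨r, hr, hrW.trans h3, κ, h4, h5.mono le_rfl hrW⟩

variable {ψ : H₂ → H₂} {U B : Set H₁} {κ : ℝ}

theorem mem_of_convex_segment (hB : Convex ℝ B) {y δ : H₂} (hy : ι y ∈ B)
    (hδ : ι (y + δ) ∈ B) {t : ℝ} (ht : t ∈ Icc (0 : ℝ) 1) : ι (y + t • δ) ∈ B := by
  have := hB.add_smul_sub_mem hy hδ ht
  simpa using this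

theorem hasDerivAt_add_smul (y δ : H₂) (t : ℝ) : HasDerivAt (fun t : ℝ => y + t • δ) δ t := by
  simpa using ((hasDerivAt_id t).smul_const δ).const_add y

/-- Mean value inequality along the segment from `y` to `y + δ`. Convexity is needed only of `B ⊆
H₁`, so `δ` may be large in `H₂`. -/
theorem TameOn.norm_fderiv_sub_le (h : TameOn ι ψ κ B) (hκ : 0 ≤ κ) (hU : IsOpen U)
    (hψ : ContDiffOn ℝ 2 ψ (ι ⁻¹' U)) (hB : Convex ℝ B) (hBU : B ⊆ U) {y δ : H₂}
    (hy : ι y ∈ B) (hδ : ι (y + δ) ∈ B) (ζ : H₂) :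
    ‖fderiv ℝ ψ (y + δ) ζ - fderiv ℝ ψ y ζ‖ ≤
      κ * (‖ι δ‖ * ‖ζ‖ + ‖δ‖ * ‖ι ζ‖ + (‖y‖ + ‖δ‖) * ‖ι δ‖ * ‖ι ζ‖) := by
  have hV : IsOpen (ι ⁻¹' U) := hU.preimage ι.continuous
  have hd : ∀ t ∈ Icc (0 : ℝ) 1, HasDerivAt (fun t : ℝ => fderiv ℝ ψ (y + t • δ) ζ)
      (fderiv ℝ (fderiv ℝ ψ) (y + t • δ) δ ζ) t := by
    intro t ht
    have hm : ι (y + t • δ) ∈ U := hBU (mem_of_convex_segment hB hy hδ ht)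
    have h1 : HasFDerivAt (fderiv ℝ ψ) (fderiv ℝ (fderiv ℝ ψ) (y + t • δ)) (y + t • δ) :=
      (((hψ.contDiffAt (hV.mem_nhds hm)).fderiv_right (m := 1) (by norm_num)).differentiableAt
        (by simp)).hasFDerivAt
    have h2 := h1.comp_hasDerivAt t (hasDerivAt_add_smul y δ t)
    simpa using h2.clm_apply (hasDerivAt_const t ζ)
  have key := norm_image_sub_le_of_norm_deriv_le_segment_01'
    (fun t ht => (hd t ht).hasDerivWithinAt) (C := κ * (‖ι δ‖ * ‖ζ‖ + ‖δ‖ * ‖ι ζ‖ +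
      (‖y‖ + ‖δ‖) * ‖ι δ‖ * ‖ι ζ‖)) fun t ht => by
    refine (h _ (mem_of_convex_segment hB hy hδ (Ico_subset_Icc_self ht)) δ ζ).trans ?_
    have : ‖y + t • δ‖ ≤ ‖y‖ + ‖δ‖ := by
      refine (norm_add_le _ _).trans (add_le_add_right ?_ _)
      rw [norm_smul, Real.norm_of_nonneg ht.1]
      exact mul_le_of_le_one_left (norm_nonneg _) ht.2.le
    gcongr
  simpa using key

theorem TameOn.norm_sub_sub_fderiv_le (h : TameOn ι ψ κ B) (hκ : 0 ≤ κ) (hU : IsOpen U)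
    (hψ : ContDiffOn ℝ 2 ψ (ι ⁻¹' U)) (hB : Convex ℝ B) (hBU : B ⊆ U) {y δ : H₂}
    (hy : ι y ∈ B) (hδ : ι (y + δ) ∈ B) :
    ‖ψ (y + δ) - ψ y - fderiv ℝ ψ y δ‖ ≤
      κ * (‖ι δ‖ * ‖δ‖ + ‖δ‖ * ‖ι δ‖ + (‖y‖ + ‖δ‖) * ‖ι δ‖ * ‖ι δ‖) := by
  have hV : IsOpen (ι ⁻¹' U) := hU.preimage ι.continuous
  have hd : ∀ t ∈ Icc (0 : ℝ) 1, HasDerivAt (fun t : ℝ => ψ (y + t • δ) - t • fderiv ℝ ψ y δ)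
      (fderiv ℝ ψ (y + t • δ) δ - fderiv ℝ ψ y δ) t := by
    intro t ht
    have hm : ι (y + t • δ) ∈ U := hBU (mem_of_convex_segment hB hy hδ ht)
    have h1 : HasFDerivAt ψ (fderiv ℝ ψ (y + t • δ)) (y + t • δ) :=
      ((hψ.contDiffAt (hV.mem_nhds hm)).differentiableAt (by simp)).hasFDerivAt
    have h2 := h1.comp_hasDerivAt t (hasDerivAt_add_smul y δ t)
    exact h2.sub (by simpa using (hasDerivAt_id t).smul_const (fderiv ℝ ψ y δ))
  have key := norm_image_sub_le_of_norm_deriv_le_segment_01'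
    (fun t ht => (hd t ht).hasDerivWithinAt) (C := κ * (‖ι δ‖ * ‖δ‖ + ‖δ‖ * ‖ι δ‖ +
      (‖y‖ + ‖δ‖) * ‖ι δ‖ * ‖ι δ‖)) fun t ht => by
    have ht' := Ico_subset_Icc_self ht
    have hn : ‖t • δ‖ ≤ ‖δ‖ := by
      rw [norm_smul, Real.norm_of_nonneg ht.1]
      exact mul_le_of_le_one_left (norm_nonneg _) ht.2.le
    have hn' : ‖ι (t • δ)‖ ≤ ‖ι δ‖ := by
      rw [map_smul, norm_smul, Real.norm_of_nonneg ht.1]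
      exact mul_le_of_le_one_left (norm_nonneg _) ht.2.le
    refine (h.norm_fderiv_sub_le hκ hU hψ hB hBU hy (mem_of_convex_segment hB hy hδ ht')
      δ).trans ?_
    gcongr
  rw [sub_right_comm]
  simpa using key

/-- Density provides a base point `y₀ ∈ H₂` near `x`, from which the two mean value estimates
propagate. The bound on `ψ y` must have no additive constant, since constants are not square
integrable on `ℝ`. -/
theorem TameOn.exists_bound_near (hι : ∀ x : H₂, ‖ι x‖ ≤ ‖x‖) (hd : DenseRange ι)
    (h : TameOn ι ψ κ B) (hκ : 0 ≤ κ) (hU : IsOpen U) (hψ : ContDiffOn ℝ 2 ψ (ι ⁻¹' U))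
    (hψ0 : ψ 0 = 0) (hB : IsOpen B) (hBU : B ⊆ U) {x : H₁} (hx : x ∈ B) :
    ∃ T ∈ nhds x, ∃ C ≥ 0, ∀ y, ι y ∈ T →
      (∀ η, ‖fderiv ℝ ψ y η‖ ≤ C * (‖η‖ + ‖y‖ * ‖ι η‖)) ∧ ‖ψ y‖ ≤ C * ‖y‖ := by
  -- Here the additive constants are absorbed. At `x = 0` take `y₀ = 0`, where `ψ` vanishes;
  -- otherwise a ball of radius at most `‖x‖ / 2` forces `‖y‖ ≥ ‖x‖ / 2`.
  obtain ⟨y₀, r, c, hr, hr1, hrB, hy₀, hc, hcy⟩ : ∃ (y₀ : H₂) (r c : ℝ), 0 < r ∧ r ≤ 1 ∧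
      Metric.ball x r ⊆ B ∧ ι y₀ ∈ Metric.ball x r ∧ 0 ≤ c ∧
      ∀ y, ι y ∈ Metric.ball x r → ‖ψ y₀‖ ≤ c * ‖y‖ ∧ ‖y₀‖ ≤ c * ‖y‖ := by
    obtain ⟨r, hr, hrB⟩ := Metric.isOpen_iff.1 hB x hx
    rcases eq_or_ne x 0 with rfl | hx0
    · exact ⟨0, min r 1, 0, lt_min hr one_pos, min_le_right _ _,
        (Metric.ball_subset_ball (min_le_left _ _)).trans hrB, by simp [hr], le_rfl, by simp [hψ0]⟩
    · have hxn : 0 < ‖x‖ := norm_pos_iff.2 hx0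
      have hr' : 0 < min (min r 1) (‖x‖ / 2) := by positivity
      obtain ⟨y₀, hy₀⟩ := hd.exists_mem_open (Metric.isOpen_ball (x := x))
        ⟨x, Metric.mem_ball_self hr'⟩
      refine ⟨y₀, min (min r 1) (‖x‖ / 2), 2 * (‖ψ y₀‖ + ‖y₀‖) / ‖x‖, hr',
        (min_le_left _ _).trans (min_le_right _ _),
        (Metric.ball_subset_ball ((min_le_left _ _).trans (min_le_left _ _))).trans hrB,
        hy₀, by positivity, fun y hy => ?_⟩
      have h1 : ‖x‖ / 2 ≤ ‖y‖ := by
        have h2 : ‖ι y - x‖ < ‖x‖ / 2 := by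
          rw [← dist_eq_norm]
          exact (Metric.mem_ball.1 hy).trans_le (min_le_right _ _)
        have h3 : ‖x‖ ≤ ‖ι y‖ + ‖ι y - x‖ := by
          simpa using norm_sub_le (ι y) (ι y - x)
        linarith [hι y]
      have h4 : ‖ψ y₀‖ + ‖y₀‖ ≤ 2 * (‖ψ y₀‖ + ‖y₀‖) / ‖x‖ * ‖y‖ := by
        calc _ = 2 * (‖ψ y₀‖ + ‖y₀‖) / ‖x‖ * (‖x‖ / 2) := by field_simp
          _ ≤ _ := by gcongr
      constructor <;> linarith [norm_nonneg (ψ y₀), norm_nonneg y₀]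
  set L := ‖fderiv ℝ ψ y₀‖ with hL
  set N := ‖y₀‖ with hN
  have hL0 : 0 ≤ L := norm_nonneg _
  have hN0 : 0 ≤ N := norm_nonneg _
  have hball : TameOn ι ψ κ (Metric.ball x r) := h.mono le_rfl hrB
  -- The first bracket is the constant for `dψ`, the second the one for `ψ`; their sum serves both.
  refine ⟨Metric.ball x r, Metric.ball_mem_nhds x hr,
    (L + 3 * κ + 5 * κ * N) + (c + (L + 8 * κ) * (1 + c) + 4 * κ * c), by positivity,
    fun y hy => ?_⟩
  have hyδ : ι (y₀ + (y - y₀)) ∈ Metric.ball x r := by rwa [add_sub_cancel]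
  have h2 : ‖ι (y - y₀)‖ ≤ 2 := by
    rw [map_sub, ← dist_eq_norm]
    have := dist_triangle_right (ι y) (ι y₀) x
    linarith [Metric.mem_ball.1 hy, Metric.mem_ball.1 hy₀]
  have hδ : ‖y - y₀‖ ≤ ‖y‖ + N := norm_sub_le _ _
  have hC : 0 ≤ c + (L + 8 * κ) * (1 + c) + 4 * κ * c := by positivity
  have hC' : 0 ≤ L + 3 * κ + 5 * κ * N := by positivity
  constructor
  · intro η
    have h1 := hball.norm_fderiv_sub_le hκ hU hψ (convex_ball x r) (hrB.trans hBU) hy₀ hyδ η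
    rw [add_sub_cancel] at h1
    have h3 : ‖fderiv ℝ ψ y η‖ ≤ ‖fderiv ℝ ψ y η - fderiv ℝ ψ y₀ η‖ + ‖fderiv ℝ ψ y₀ η‖ := by
      simpa using norm_add_le (fderiv ℝ ψ y η - fderiv ℝ ψ y₀ η) (fderiv ℝ ψ y₀ η)
    have h4 : ‖fderiv ℝ ψ y₀ η‖ ≤ L * ‖η‖ := (fderiv ℝ ψ y₀).le_opNorm η
    have h5 : κ * (‖ι (y - y₀)‖ * ‖η‖ + ‖y - y₀‖ * ‖ι η‖ +
        (‖y₀‖ + ‖y - y₀‖) * ‖ι (y - y₀)‖ * ‖ι η‖) ≤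
        κ * (2 * ‖η‖ + (‖y‖ + N) * ‖ι η‖ + (N + (‖y‖ + N)) * 2 * ‖ι η‖) := by gcongr
    have h6 : κ * (2 * ‖η‖ + (‖y‖ + N) * ‖ι η‖ + (N + (‖y‖ + N)) * 2 * ‖ι η‖) =
        2 * κ * ‖η‖ + 5 * κ * N * ‖ι η‖ + 3 * κ * (‖y‖ * ‖ι η‖) := by ring
    have h7 : 5 * κ * N * ‖ι η‖ ≤ 5 * κ * N * ‖η‖ := by
      gcongr
      exact hι η
    have h8 : 3 * κ * (‖y‖ * ‖ι η‖) ≤ (L + 3 * κ + 5 * κ * N) * (‖y‖ * ‖ι η‖) := by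
      refine mul_le_mul_of_nonneg_right ?_ (by positivity)
      have : 0 ≤ 5 * κ * N := by positivity
      linarith
    have h9 : (L + 3 * κ + 5 * κ * N) * (‖η‖ + ‖y‖ * ‖ι η‖) ≤
        ((L + 3 * κ + 5 * κ * N) + (c + (L + 8 * κ) * (1 + c) + 4 * κ * c)) *
          (‖η‖ + ‖y‖ * ‖ι η‖) :=
      mul_le_mul_of_nonneg_right (by linarith) (by positivity)
    have h10 : 0 ≤ κ * ‖η‖ := by positivity
    nlinarith
  · obtain ⟨hc1, hc2⟩ := hcy y hy
    have h1 := hball.norm_sub_sub_fderiv_le hκ hU hψ (convex_ball x r) (hrB.trans hBU) hy₀ hyδ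
    rw [add_sub_cancel] at h1
    have h3 : ‖ψ y‖ ≤ ‖ψ y - ψ y₀ - fderiv ℝ ψ y₀ (y - y₀)‖ + ‖ψ y₀‖ +
        ‖fderiv ℝ ψ y₀ (y - y₀)‖ := by
      have e : ψ y = (ψ y - ψ y₀ - fderiv ℝ ψ y₀ (y - y₀)) + ψ y₀ + fderiv ℝ ψ y₀ (y - y₀) := by
        abel
      conv_lhs => rw [e]
      exact norm_add₃_le
    have hδ' : ‖y - y₀‖ ≤ (1 + c) * ‖y‖ := by linarith
    have h4 : ‖fderiv ℝ ψ y₀ (y - y₀)‖ ≤ L * ((1 + c) * ‖y‖) :=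
      ((fderiv ℝ ψ y₀).le_opNorm _).trans (by gcongr)
    have h5 : κ * (‖ι (y - y₀)‖ * ‖y - y₀‖ + ‖y - y₀‖ * ‖ι (y - y₀)‖ +
        (‖y₀‖ + ‖y - y₀‖) * ‖ι (y - y₀)‖ * ‖ι (y - y₀)‖) ≤
        κ * (2 * ((1 + c) * ‖y‖) + ((1 + c) * ‖y‖) * 2 +
          (c * ‖y‖ + (1 + c) * ‖y‖) * 2 * 2) := by gcongr
    have h6 : 0 ≤ (L + 3 * κ + 5 * κ * N) * ‖y‖ := by positivity
    nlinarith

theorem exists_tame_bound (hι : ∀ x : H₂, ‖ι x‖ ≤ ‖x‖) (hd : DenseRange ι)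
    (h : ∀ x ∈ U, ∃ W : Set H₁, IsOpen W ∧ x ∈ W ∧ W ⊆ U ∧ ∃ κ : ℝ, 0 < κ ∧ TameOn ι ψ κ W)
    (hU : IsOpen U) (hψ : ContDiffOn ℝ 2 ψ (ι ⁻¹' U)) (hψ0 : ψ 0 = 0) {K : Set H₁}
    (hK : IsCompact K) (hKU : K ⊆ U) :
    ∃ C ≥ 0, ∀ y, ι y ∈ K →
      (∀ η, ‖fderiv ℝ ψ y η‖ ≤ C * (‖η‖ + ‖y‖ * ‖ι η‖)) ∧ ‖ψ y‖ ≤ C * ‖y‖ := by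
  refine hK.induction_on (p := fun S => ∃ C ≥ 0, ∀ y, ι y ∈ S →
    (∀ η, ‖fderiv ℝ ψ y η‖ ≤ C * (‖η‖ + ‖y‖ * ‖ι η‖)) ∧ ‖ψ y‖ ≤ C * ‖y‖) ?_ ?_ ?_ ?_
  · exact ⟨0, le_rfl, fun y hy => hy.elim⟩
  · rintro S T hST ⟨C, hC, h1⟩
    exact ⟨C, hC, fun y hy => h1 y (hST hy)⟩
  · rintro S T ⟨C, hC, h1⟩ ⟨D, hD, h2⟩
    refine ⟨max C D, le_max_of_le_left hC, fun y hy => ?_⟩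
    rcases hy with hy | hy
    · refine ⟨fun η => ((h1 y hy).1 η).trans ?_, (h1 y hy).2.trans ?_⟩ <;> gcongr <;>
        exact le_max_left _ _
    · refine ⟨fun η => ((h2 y hy).1 η).trans ?_, (h2 y hy).2.trans ?_⟩ <;> gcongr <;>
        exact le_max_right _ _
  · intro x hx
    obtain ⟨W, hW, hxW, hWU, κ, hκ, hT⟩ := h x (hKU hx)
    obtain ⟨T, hTx, hT'⟩ := hT.exists_bound_near hι hd hκ.le hU hψ hψ0 hW hWU hxW
    exact ⟨T, mem_nhdsWithin_of_mem_nhds hTx, hT'⟩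

end Tame

/-! ### Superposition by `ψ` as a map into `L²(ℝ, H₂)`. -/

theorem MeasureTheory.Lp.norm_le_of_ae_norm_le_add {E F G H : Type*} [NormedAddCommGroup E]
    [NormedAddCommGroup F] [NormedAddCommGroup G] [NormedAddCommGroup H]
    {f : Lp E 2 (volume : Measure ℝ)} {u : Lp F 2 (volume : Measure ℝ)}
    {v : Lp G 2 (volume : Measure ℝ)} {w : Lp H 2 (volume : Measure ℝ)} {a b c : ℝ}
    (ha : 0 ≤ a) (hb : 0 ≤ b) (hc : 0 ≤ c)
    (h : ∀ᵐ s, ‖f s‖ ≤ a * ‖u s‖ + b * ‖v s‖ + c * ‖w s‖) :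
    ‖f‖ ≤ a * ‖u‖ + b * ‖v‖ + c * ‖w‖ := by
  set u' := (Lp.memLp u).norm.toLp _
  set v' := (Lp.memLp v).norm.toLp _
  set w' := (Lp.memLp w).norm.toLp _
  have hu : ‖u'‖ = ‖u‖ := by rw [Lp.norm_toLp, eLpNorm_norm, Lp.norm_def]
  have hv : ‖v'‖ = ‖v‖ := by rw [Lp.norm_toLp, eLpNorm_norm, Lp.norm_def]
  have hw : ‖w'‖ = ‖w‖ := by rw [Lp.norm_toLp, eLpNorm_norm, Lp.norm_def]
  have key : ‖f‖ ≤ ‖a • u' + b • v' + c • w'‖ := by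
    refine Lp.norm_le_norm_of_ae_le ?_
    filter_upwards [h, (Lp.memLp u).norm.coeFn_toLp, (Lp.memLp v).norm.coeFn_toLp,
      (Lp.memLp w).norm.coeFn_toLp, Lp.coeFn_add (a • u' + b • v') (c • w'),
      Lp.coeFn_add (a • u') (b • v'), Lp.coeFn_smul a u', Lp.coeFn_smul b v', Lp.coeFn_smul c w']
      with s h0 h1 h2 h3 h4 h5 h6 h7 h8
    rw [h4, Pi.add_apply, h5, Pi.add_apply, h6, h7, h8, Pi.smul_apply, Pi.smul_apply,
      Pi.smul_apply, h1, h2, h3]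
    exact h0.trans (le_abs_self _)
  refine key.trans (norm_add₃_le.trans ?_)
  rw [norm_smul, norm_smul, norm_smul, hu, hv, hw, Real.norm_of_nonneg ha, Real.norm_of_nonneg hb,
    Real.norm_of_nonneg hc]

theorem ContinuousOn.aestronglyMeasurable_comp {α E F : Type*} [MeasurableSpace α] {μ : Measure α}
    [TopologicalSpace E] [TopologicalSpace.PseudoMetrizableSpace E]
    [TopologicalSpace F] [TopologicalSpace.PseudoMetrizableSpace F] [SecondCountableTopology F]
    {f : E → F} {V : Set E} (hf : ContinuousOn f V) (hV : IsOpen V) {u : α → E}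
    (hu : AEStronglyMeasurable u μ) (huV : ∀ᵐ s ∂μ, u s ∈ V) :
    AEStronglyMeasurable (fun s => f (u s)) μ := by
  borelize E
  have h1 : ∀ᵐ y ∂(μ.map u), y ∈ V :=
    (ae_map_iff hu.aemeasurable hV.measurableSet).2 huV
  have h2 := hf.aestronglyMeasurable (μ := μ.map u) hV.measurableSet
  rw [Measure.restrict_eq_self_of_ae_mem h1] at h2
  exact h2.comp_aemeasurable hu.aemeasurable

section PathSpace

variable {H₁ H₂ : Type*} [NormedAddCommGroup H₁] [InnerProductSpace ℝ H₁]
  [NormedAddCommGroup H₂] [InnerProductSpace ℝ H₂]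

/-- The underlying path, as a continuous linear map. -/
noncomputable def pathOfL (ι : H₂ →L[ℝ] H₁) : pathSpace ι →L[ℝ] Lp H₂ 2 (volume : Measure ℝ) :=
  (WithLp.fstL 2 ℝ _ _).comp (pathSpace ι).subtypeL

/-- The weak derivative, as a continuous linear map. -/
noncomputable def weakDerivL (ι : H₂ →L[ℝ] H₁) :
    pathSpace ι →L[ℝ] Lp H₁ 2 (volume : Measure ℝ) :=
  (WithLp.sndL 2 ℝ _ _).comp (pathSpace ι).subtypeL

theorem integral_inner_coeFn_eq {f : Lp H₁ 2 (volume : Measure ℝ)} {χ : ℝ → H₁}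
    (hχ : MemLp χ 2 (volume : Measure ℝ)) :
    ∫ t, inner ℝ (f t) (χ t) = inner ℝ f (hχ.toLp χ) := by
  rw [L2.inner_def]
  refine integral_congr_ae ?_
  filter_upwards [hχ.coeFn_toLp] with t ht
  rw [ht]

/-- Each test function imposes the equality of two continuous functionals. Closedness makes the
orthogonal projection onto `pathSpace ι` available. -/
theorem isClosed_pathSpace (ι : H₂ →L[ℝ] H₁) : IsClosed (pathSpace ι : Set
    (WithLp 2 (Lp H₂ 2 (volume : Measure ℝ) × Lp H₁ 2 (volume : Measure ℝ)))) := by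
  have e : (pathSpace ι : Set
      (WithLp 2 (Lp H₂ 2 (volume : Measure ℝ) × Lp H₁ 2 (volume : Measure ℝ)))) =
      ⋂ (χ : ℝ → H₁) (h : ContDiff ℝ ∞ χ) (hc : HasCompactSupport χ),
        {p | inner ℝ (ι.compLp p.fst) ((memLp_two_of_test_deriv h hc).toLp _) =
          -inner ℝ p.snd ((memLp_two_of_test h hc).toLp _)} := by
    ext p
    simp only [mem_iInter]
    refine forall_congr' fun χ => forall_congr' fun h => forall_congr' fun hc => ?_
    rw [mem_ofPred_eq, ← integral_inner_coeFn_eq, ← integral_inner_coeFn_eq]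
    have : ∫ t, inner ℝ (ι.compLp p.fst t) (deriv χ t) = ∫ t, inner ℝ (ι (p.fst t)) (deriv χ t) := by
      refine integral_congr_ae ?_
      filter_upwards [ι.coeFn_compLp p.fst] with t ht
      rw [ht]
    rw [this]
  rw [e]
  refine isClosed_iInter fun χ => isClosed_iInter fun h => isClosed_iInter fun hc =>
    isClosed_eq ?_ ?_
  · exact (((ContinuousLinearMap.compLpL 2 volume ι).comp
      (WithLp.fstL 2 ℝ (Lp H₂ 2 (volume : Measure ℝ))
        (Lp H₁ 2 (volume : Measure ℝ)))).continuous).inner continuous_const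
  · exact ((WithLp.sndL 2 ℝ (Lp H₂ 2 (volume : Measure ℝ))
      (Lp H₁ 2 (volume : Measure ℝ))).continuous.inner continuous_const).neg

variable [CompleteSpace H₁] {ι : H₂ →L[ℝ] H₁} {ψ : H₂ → H₂} {U : Set H₁}

theorem ae_mem_of_mem_pathDomain {ξ : pathSpace ι} (hξ : ξ ∈ pathDomain ι U) :
    ∀ᵐ s, ι (pathOf ξ s) ∈ U := by
  filter_upwards [contRep_ae_eq ξ] with s hs
  rw [← hs]
  exact mem_pathDomain_iff.1 hξ s

open Classical in
/-- The superposition operator `ξ ↦ ψ ∘ ξ` into `L²`, with value `0` if `ψ ∘ ξ` is not in `L²`. -/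
noncomputable def superposeLp (ι : H₂ →L[ℝ] H₁) (ψ : H₂ → H₂) (ξ : pathSpace ι) :
    Lp H₂ 2 (volume : Measure ℝ) :=
  if h : MemLp (fun s => ψ (pathOf ξ s)) 2 volume then h.toLp _ else 0

open Classical in
/-- The multiplication operator `ζ ↦ dψ(ξ) ζ` into `L²`, with value `0` if it is not bounded. -/
noncomputable def derivSuperposeLp (ι : H₂ →L[ℝ] H₁) (ψ : H₂ → H₂) (ξ : pathSpace ι) :
    pathSpace ι →L[ℝ] Lp H₂ 2 (volume : Measure ℝ) :=
  if h : ∃ L : pathSpace ι →L[ℝ] Lp H₂ 2 (volume : Measure ℝ),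
    ∀ ζ, ∀ᵐ s, L ζ s = fderiv ℝ ψ (pathOf ξ s) (pathOf ζ s) then h.choose else 0

variable [SecondCountableTopology H₂]

theorem superposeLp_ae_eq {C : ℝ} (hU : IsOpen U)
    (hψ : ContDiffOn ℝ 2 ψ (ι ⁻¹' U)) {ξ : pathSpace ι} (hξ : ξ ∈ pathDomain ι U)
    (hb : ∀ᵐ s, ‖ψ (pathOf ξ s)‖ ≤ C * ‖pathOf ξ s‖) :
    ∀ᵐ s, superposeLp ι ψ ξ s = ψ (pathOf ξ s) := by
  have h : MemLp (fun s => ψ (pathOf ξ s)) 2 volume :=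
    (Lp.memLp (pathOf ξ)).of_le_mul (hψ.continuousOn.aestronglyMeasurable_comp
      (hU.preimage ι.continuous) (Lp.aestronglyMeasurable _) (ae_mem_of_mem_pathDomain hξ)) hb
  rw [superposeLp, dif_pos h]
  exact h.coeFn_toLp

/-- In the term `‖ξ(s)‖ ‖ι ζ(s)‖` the factor `ζ` is bounded by the Sobolev embedding and `ξ` is kept
in `L²`. Hence the operator is bounded in the norm of `pathSpace ι`. -/
theorem derivSuperposeLp_ae_eq (hι : ∀ x : H₂, ‖ι x‖ ≤ ‖x‖) {C : ℝ} (hC : 0 ≤ C) (hU : IsOpen U)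
    (hψ : ContDiffOn ℝ 2 ψ (ι ⁻¹' U)) {ξ : pathSpace ι} (hξ : ξ ∈ pathDomain ι U)
    (hb : ∀ᵐ s, ∀ η, ‖fderiv ℝ ψ (pathOf ξ s) η‖ ≤ C * (‖η‖ + ‖pathOf ξ s‖ * ‖ι η‖))
    (ζ : pathSpace ι) :
    ∀ᵐ s, derivSuperposeLp ι ψ ξ ζ s = fderiv ℝ ψ (pathOf ξ s) (pathOf ζ s) := by
  have hV : IsOpen (ι ⁻¹' U) := hU.preimage ι.continuous
  have hc : ContinuousOn (fun p : H₂ × H₂ => fderiv ℝ ψ p.1 p.2) ((ι ⁻¹' U) ×ˢ univ) :=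
    ((hψ.continuousOn_fderiv_of_isOpen hV (by norm_num)).comp continuousOn_fst
      fun p hp => hp.1).clm_apply continuousOn_snd
  have hbd : ∀ ζ : pathSpace ι, ∀ᵐ s, ‖fderiv ℝ ψ (pathOf ξ s) (pathOf ζ s)‖ ≤
      C * ‖pathOf ζ s‖ + (C * (2 * ‖ζ‖)) * ‖pathOf ξ s‖ := by
    intro ζ
    filter_upwards [hb, contRep_ae_eq ζ] with s h1 h2
    refine (h1 _).trans ?_
    have h3 := norm_contRep_le hι ζ s
    rw [h2] at h3
    have h4 : ‖pathOf ξ s‖ * ‖ι (pathOf ζ s)‖ ≤ ‖pathOf ξ s‖ * (2 * ‖ζ‖) := by gcongr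
    nlinarith
  have hmem : ∀ ζ : pathSpace ι,
      MemLp (fun s => fderiv ℝ ψ (pathOf ξ s) (pathOf ζ s)) 2 volume := by
    intro ζ
    have hm : AEStronglyMeasurable (fun s => fderiv ℝ ψ (pathOf ξ s) (pathOf ζ s)) volume :=
      hc.aestronglyMeasurable_comp (u := fun s => (pathOf ξ s, pathOf ζ s)) (hV.prod isOpen_univ)
        ((Lp.aestronglyMeasurable _).prodMk (Lp.aestronglyMeasurable _)) (by
          filter_upwards [ae_mem_of_mem_pathDomain hξ] with s hs using ⟨hs, mem_univ _⟩)
    have hg : MemLp (fun s => C * ‖pathOf ζ s‖ + (C * (2 * ‖ζ‖)) * ‖pathOf ξ s‖) 2 volume :=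
      ((Lp.memLp (pathOf ζ)).norm.const_mul C).add ((Lp.memLp (pathOf ξ)).norm.const_mul _)
    refine hg.of_le hm ((hbd ζ).mono fun s hs => hs.trans (le_abs_self _))
  have hL : ∃ L : pathSpace ι →L[ℝ] Lp H₂ 2 (volume : Measure ℝ),
      ∀ ζ, ∀ᵐ s, L ζ s = fderiv ℝ ψ (pathOf ξ s) (pathOf ζ s) := by
    refine ⟨LinearMap.mkContinuous
      { toFun := fun ζ => (hmem ζ).toLp _
        map_add' := fun ζ ζ' => by
          rw [← MemLp.toLp_add]
          refine MemLp.toLp_congr _ _ ?_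
          filter_upwards [Lp.coeFn_add (pathOf ζ) (pathOf ζ')] with s hs
          have e : pathOf (ζ + ζ') s = pathOf ζ s + pathOf ζ' s := hs
          rw [e, map_add, Pi.add_apply]
        map_smul' := fun c ζ => by
          rw [RingHom.id_apply, ← MemLp.toLp_const_smul]
          refine MemLp.toLp_congr _ _ ?_
          filter_upwards [Lp.coeFn_smul c (pathOf ζ)] with s hs
          have e : pathOf (c • ζ) s = c • pathOf ζ s := hs
          rw [e, map_smul, Pi.smul_apply] }
      (C + 2 * C * ‖pathOf ξ‖) fun ζ => ?_, fun ζ => (hmem ζ).coeFn_toLp⟩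
    have := Lp.norm_le_of_ae_norm_le_add (f := (hmem ζ).toLp _) (u := pathOf ζ) (v := pathOf ξ)
      (w := pathOf ξ) hC (b := C * (2 * ‖ζ‖)) (by positivity) (le_refl 0) (by
        filter_upwards [(hmem ζ).coeFn_toLp, hbd ζ] with s h1 h2
        rw [h1]
        simpa using h2)
    refine this.trans ?_
    have h5 : C * ‖pathOf ζ‖ ≤ C * ‖ζ‖ := mul_le_mul_of_nonneg_left (norm_pathOf_le ζ) hC
    linarith
  rw [derivSuperposeLp, dif_pos hL]
  exact hL.choose_spec ζ

end PathSpace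

/-! ### Differentiability of superposition by a tame map. -/

section Superposition

variable {H₁ H₂ : Type*} [NormedAddCommGroup H₁] [InnerProductSpace ℝ H₁] [CompleteSpace H₁]
  [NormedAddCommGroup H₂] [InnerProductSpace ℝ H₂] [SecondCountableTopology H₂]
  {ι : H₂ →L[ℝ] H₁} {ψ : H₂ → H₂} {U : Set H₁}

/-- A tame map acts on paths, and so does its derivative. -/
theorem superposeLp_and_derivSuperposeLp_ae_eq (hι : ∀ x : H₂, ‖ι x‖ ≤ ‖x‖) (hd : DenseRange ι)
    (h : ∀ x ∈ U, ∃ W : Set H₁, IsOpen W ∧ x ∈ W ∧ W ⊆ U ∧ ∃ κ : ℝ, 0 < κ ∧ TameOn ι ψ κ W)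
    (hU : IsOpen U) (h0 : (0 : H₁) ∈ U) (hψ : ContDiffOn ℝ 2 ψ (ι ⁻¹' U)) (hψ0 : ψ 0 = 0)
    {ξ : pathSpace ι} (hξ : ξ ∈ pathDomain ι U) :
    (∀ᵐ s, superposeLp ι ψ ξ s = ψ (pathOf ξ s)) ∧
    ∀ ζ, ∀ᵐ s, derivSuperposeLp ι ψ ξ ζ s = fderiv ℝ ψ (pathOf ξ s) (pathOf ζ s) := by
  obtain ⟨C, hC, hb⟩ := exists_tame_bound hι hd h hU hψ hψ0 (isCompact_insert_range_contRep ξ)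
    (insert_range_contRep_subset h0 hξ)
  have hK : ∀ᵐ s, ι (pathOf ξ s) ∈ insert 0 (range (contRep ξ)) := by
    filter_upwards [contRep_ae_eq ξ] with s hs
    rw [← hs]
    exact mem_insert_of_mem _ (mem_range_self s)
  exact ⟨superposeLp_ae_eq hU hψ hξ (hK.mono fun s hs => (hb _ hs).2),
    derivSuperposeLp_ae_eq hι hC hU hψ hξ (hK.mono fun s hs => (hb _ hs).1)⟩

theorem exists_superposeLp_estimates (hι : ∀ x : H₂, ‖ι x‖ ≤ ‖x‖) (hd : DenseRange ι)
    (h : ∀ x ∈ U, ∃ W : Set H₁, IsOpen W ∧ x ∈ W ∧ W ⊆ U ∧ ∃ κ : ℝ, 0 < κ ∧ TameOn ι ψ κ W)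
    (hU : IsOpen U) (h0 : (0 : H₁) ∈ U) (hψ : ContDiffOn ℝ 2 ψ (ι ⁻¹' U)) (hψ0 : ψ 0 = 0)
    {ξ : pathSpace ι} (hξ : ξ ∈ pathDomain ι U) :
    ∃ M ≥ 0, ∀ᶠ ξ' in nhds ξ,
      ‖superposeLp ι ψ ξ' - superposeLp ι ψ ξ - derivSuperposeLp ι ψ ξ (ξ' - ξ)‖ ≤
        M * ‖ξ' - ξ‖ * ‖ξ' - ξ‖ ∧
      ‖derivSuperposeLp ι ψ ξ' - derivSuperposeLp ι ψ ξ‖ ≤ M * ‖ξ' - ξ‖ := by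
  obtain ⟨r, hr, hrU, κ, hκ, hT⟩ := exists_tameOn_thickening h (isCompact_insert_range_contRep ξ)
    (insert_range_contRep_subset h0 hξ)
  -- The thickening need not be convex; the mean value estimates are used on these balls, with the
  -- common constant `κ`.
  have hball : ∀ s, Metric.ball (contRep ξ s) r ⊆
      Metric.thickening r (insert 0 (range (contRep ξ))) := fun s =>
    Metric.ball_subset_thickening (mem_insert_of_mem _ (mem_range_self s)) r
  refine ⟨4 * κ * (2 + ‖ξ‖), by positivity, ?_⟩
  -- The bound `r / 2` keeps `ξ' s` in the ball of radius `r`, given the embedding constant `2`; the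
  -- bound `1` turns `1 + ‖δ‖ + ‖ξ‖` into `2 + ‖ξ‖`.
  have hρ : 0 < min (r / 2) 1 := by positivity
  filter_upwards [(isOpen_pathDomain hι hU h0).mem_nhds hξ, Metric.ball_mem_nhds ξ hρ]
    with ξ' hξ' hξb
  set δ := ξ' - ξ with hδ
  have hδn : ‖δ‖ < min (r / 2) 1 := by rwa [Metric.mem_ball, dist_eq_norm] at hξb
  have hδ1 : ‖δ‖ ≤ 1 := hδn.le.trans (min_le_right _ _)
  have hδr : 2 * ‖δ‖ < r := by linarith [min_le_left (r / 2) 1]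
  obtain ⟨e1, e2⟩ := superposeLp_and_derivSuperposeLp_ae_eq hι hd h hU h0 hψ hψ0 hξ
  obtain ⟨e1', e2'⟩ := superposeLp_and_derivSuperposeLp_ae_eq hι hd h hU h0 hψ hψ0 hξ'
  have hpt : ∀ᵐ s, ι (pathOf ξ s) ∈ Metric.ball (contRep ξ s) r ∧
      ι (pathOf ξ s + pathOf δ s) ∈ Metric.ball (contRep ξ s) r ∧
      pathOf ξ' s = pathOf ξ s + pathOf δ s := by
    filter_upwards [contRep_ae_eq ξ, contRep_ae_eq ξ', Lp.coeFn_sub (pathOf ξ') (pathOf ξ)]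
      with s h1 h2 h3
    have h4 : pathOf ξ' s = pathOf ξ s + pathOf δ s := by
      have : pathOf δ s = pathOf ξ' s - pathOf ξ s := h3
      rw [this, add_sub_cancel]
    refine ⟨by rw [← h1]; exact Metric.mem_ball_self hr, ?_, h4⟩
    rw [← h4, ← h2, Metric.mem_ball, dist_eq_norm]
    exact (norm_contRep_sub_le hι ξ' ξ s).trans_lt hδr
  have hsup : ∀ ζ : pathSpace ι, ∀ᵐ s, ‖ι (pathOf ζ s)‖ ≤ 2 * ‖ζ‖ := fun ζ => by
    filter_upwards [contRep_ae_eq ζ] with s hs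
    rw [← hs]
    exact norm_contRep_le hι ζ s
  have hpath : ∀ ζ : pathSpace ι, ‖pathOf ζ‖ ≤ ‖ζ‖ := norm_pathOf_le
  -- the common shape of the two estimates
  have hmain : ∀ (ζ : pathSpace ι) (f : Lp H₂ 2 (volume : Measure ℝ)),
      (∀ᵐ s, ‖f s‖ ≤ κ * (‖ι (pathOf δ s)‖ * ‖pathOf ζ s‖ + ‖pathOf δ s‖ * ‖ι (pathOf ζ s)‖ +
        (‖pathOf ξ s‖ + ‖pathOf δ s‖) * ‖ι (pathOf δ s)‖ * ‖ι (pathOf ζ s)‖)) →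
      ‖f‖ ≤ 4 * κ * (2 + ‖ξ‖) * ‖δ‖ * ‖ζ‖ := by
    intro ζ f hf
    -- All `H₁`-norms are replaced by sup bounds; the remaining `H₂`-norms of `ζ`, `δ` and `ξ` occur
    -- linearly and are integrated.
    have h1 := Lp.norm_le_of_ae_norm_le_add (f := f) (u := pathOf ζ) (v := pathOf δ)
      (w := pathOf ξ) (a := κ * (2 * ‖δ‖)) (b := κ * (2 * ‖ζ‖ + 2 * ‖δ‖ * (2 * ‖ζ‖)))
      (c := κ * (2 * ‖δ‖ * (2 * ‖ζ‖))) (by positivity) (by positivity) (by positivity) (by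
        filter_upwards [hf, hsup δ, hsup ζ] with s g1 g2 g3
        calc ‖f s‖ ≤ _ := g1
          _ ≤ κ * (2 * ‖δ‖ * ‖pathOf ζ s‖ + ‖pathOf δ s‖ * (2 * ‖ζ‖) +
            (‖pathOf ξ s‖ + ‖pathOf δ s‖) * (2 * ‖δ‖) * (2 * ‖ζ‖)) := by gcongr
          _ = _ := by ring)
    calc ‖f‖ ≤ _ := h1
      _ ≤ κ * (2 * ‖δ‖) * ‖ζ‖ + κ * (2 * ‖ζ‖ + 2 * ‖δ‖ * (2 * ‖ζ‖)) * ‖δ‖ +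
          κ * (2 * ‖δ‖ * (2 * ‖ζ‖)) * ‖ξ‖ := by
        gcongr
        exacts [hpath ζ, hpath δ, hpath ξ]
      _ = 4 * κ * (1 + ‖δ‖ + ‖ξ‖) * ‖δ‖ * ‖ζ‖ := by ring
      _ ≤ 4 * κ * (2 + ‖ξ‖) * ‖δ‖ * ‖ζ‖ := by
        gcongr
        linarith
  constructor
  · refine hmain δ _ ?_
    filter_upwards [hpt, e1, e1', e2 δ, Lp.coeFn_sub (superposeLp ι ψ ξ' - superposeLp ι ψ ξ)
      (derivSuperposeLp ι ψ ξ δ), Lp.coeFn_sub (superposeLp ι ψ ξ') (superposeLp ι ψ ξ)]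
      with s ⟨p1, p2, p3⟩ g1 g2 g3 g4 g5
    rw [g4, Pi.sub_apply, g5, Pi.sub_apply, g1, g2, g3, p3]
    exact (hT.mono le_rfl (hball s)).norm_sub_sub_fderiv_le hκ.le hU hψ (convex_ball _ _)
      ((hball s).trans hrU) p1 p2
  · refine ContinuousLinearMap.opNorm_le_bound _ (by positivity) fun ζ => hmain ζ _ ?_
    filter_upwards [hpt, e2 ζ, e2' ζ, Lp.coeFn_sub (derivSuperposeLp ι ψ ξ' ζ)
      (derivSuperposeLp ι ψ ξ ζ)] with s ⟨p1, p2, p3⟩ g1 g2 g3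
    rw [sub_apply, g3, Pi.sub_apply, g1, g2, p3]
    exact (hT.mono le_rfl (hball s)).norm_fderiv_sub_le hκ.le hU hψ (convex_ball _ _)
      ((hball s).trans hrU) p1 p2 _

theorem hasFDerivAt_superposeLp (hι : ∀ x : H₂, ‖ι x‖ ≤ ‖x‖) (hd : DenseRange ι)
    (h : ∀ x ∈ U, ∃ W : Set H₁, IsOpen W ∧ x ∈ W ∧ W ⊆ U ∧ ∃ κ : ℝ, 0 < κ ∧ TameOn ι ψ κ W)
    (hU : IsOpen U) (h0 : (0 : H₁) ∈ U) (hψ : ContDiffOn ℝ 2 ψ (ι ⁻¹' U)) (hψ0 : ψ 0 = 0)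
    {ξ : pathSpace ι} (hξ : ξ ∈ pathDomain ι U) :
    HasFDerivAt (superposeLp ι ψ) (derivSuperposeLp ι ψ ξ) ξ := by
  obtain ⟨M, hM, hev⟩ := exists_superposeLp_estimates hι hd h hU h0 hψ hψ0 hξ
  rw [hasFDerivAt_iff_isLittleO, Asymptotics.isLittleO_iff]
  intro ε hε
  have hc : Filter.Tendsto (fun ξ' => M * ‖ξ' - ξ‖) (nhds ξ) (nhds 0) := by
    have : Continuous fun ξ' => M * ‖ξ' - ξ‖ := by fun_prop
    simpa using this.tendsto ξ
  filter_upwards [hev, hc.eventually (gt_mem_nhds hε)] with ξ' h1 h2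
  exact h1.1.trans (mul_le_mul_of_nonneg_right h2.le (norm_nonneg _))

theorem contDiffOn_superposeLp (hι : ∀ x : H₂, ‖ι x‖ ≤ ‖x‖) (hd : DenseRange ι)
    (h : ∀ x ∈ U, ∃ W : Set H₁, IsOpen W ∧ x ∈ W ∧ W ⊆ U ∧ ∃ κ : ℝ, 0 < κ ∧ TameOn ι ψ κ W)
    (hU : IsOpen U) (h0 : (0 : H₁) ∈ U) (hψ : ContDiffOn ℝ 2 ψ (ι ⁻¹' U)) (hψ0 : ψ 0 = 0) :
    ContDiffOn ℝ 1 (superposeLp ι ψ) (pathDomain ι U) := by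
  refine contDiffOn_one_of_hasFDerivAt (isOpen_pathDomain hι hU h0)
    (fun ξ hξ => hasFDerivAt_superposeLp hι hd h hU h0 hψ hψ0 hξ)
    fun ξ hξ => ContinuousAt.continuousWithinAt ?_
  obtain ⟨M, hM, hev⟩ := exists_superposeLp_estimates hι hd h hU h0 hψ hψ0 hξ
  refine (tendsto_iff_norm_sub_tendsto_zero
    (E := pathSpace ι →L[ℝ] Lp H₂ 2 (volume : Measure ℝ))).2 ?_
  have hc : Filter.Tendsto (fun ξ' => M * ‖ξ' - ξ‖) (nhds ξ) (nhds 0) := by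
    have : Continuous fun ξ' => M * ‖ξ' - ξ‖ := by fun_prop
    simpa using this.tendsto ξ
  exact squeeze_zero' (.of_forall fun ξ' => ContinuousLinearMap.opNorm_nonneg
    (derivSuperposeLp ι ψ ξ' - derivSuperposeLp ι ψ ξ)) (hev.mono fun ξ' h1 => h1.2) hc

end Superposition

/-! ### Assembly of the maps `Φ` and `TΦ`. -/

theorem theoremB
    {H₁ : Type*} [NormedAddCommGroup H₁] [InnerProductSpace ℝ H₁] [CompleteSpace H₁]
    [TopologicalSpace.SeparableSpace H₁]
    {H₂ : Type*} [NormedAddCommGroup H₂] [InnerProductSpace ℝ H₂] [CompleteSpace H₂]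
    [TopologicalSpace.SeparableSpace H₂]
    (ι : H₂ →L[ℝ] H₁) (hι_inj : Function.Injective ι) (hι_dense : DenseRange ι)
    (hι_norm : ∀ x : H₂, ‖ι x‖ ≤ ‖x‖)
    (U₁ : Set H₁) (hU₁ : IsOpen U₁) (h0 : (0 : H₁) ∈ U₁)
    (φ : H₁ → H₁) (hφ : IsTame ι U₁ φ) (hφ0 : φ 0 = 0) :
    IsOpen (pathDomain ι U₁) ∧
    ∃ Φ : pathSpace ι → pathSpace ι,
      (∀ ξ ∈ pathDomain ι U₁, ∀ᵐ s : ℝ, ι (pathOf (Φ ξ) s) = φ (ι (pathOf ξ s))) ∧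
      ContDiffOn ℝ 1 Φ (pathDomain ι U₁) ∧
      (∀ ξ ∈ pathDomain ι U₁, ∀ ζ : pathSpace ι, ∀ᵐ s : ℝ,
        ι (pathOf (fderiv ℝ Φ ξ ζ) s) = fderiv ℝ φ (ι (pathOf ξ s)) (ι (pathOf ζ s))) ∧
      ∃ TΦ : pathSpace ι × Lp H₁ 2 (volume : Measure ℝ) →
          pathSpace ι × Lp H₁ 2 (volume : Measure ℝ),
        (∀ ξ ∈ pathDomain ι U₁, ∀ η : Lp H₁ 2 (volume : Measure ℝ),
          (TΦ (ξ, η)).1 = Φ ξ ∧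
          ∀ᵐ s : ℝ, (TΦ (ξ, η)).2 s = fderiv ℝ φ (ι (pathOf ξ s)) (η s)) ∧
        ContDiffOn ℝ 1 TΦ (pathDomain ι U₁ ×ˢ univ) := by
  obtain ⟨hφ2, ψ, hψφ, hψ2, hT⟩ := hφ
  have hψ0 : ψ 0 = 0 := hι_inj (by rw [hψφ 0 (by simpa using h0), map_zero, hφ0])
  have : SecondCountableTopology H₂ := UniformSpace.secondCountable_of_separable H₂
  have hopen := isOpen_pathDomain hι_norm hU₁ h0
  have hV : IsOpen (ι ⁻¹' U₁) := hU₁.preimage ι.continuous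
  have hcl : IsComplete (pathSpace ι : Set
      (WithLp 2 (Lp H₂ 2 (volume : Measure ℝ) × Lp H₁ 2 (volume : Measure ℝ)))) :=
    (isClosed_pathSpace ι).isComplete
  have : CompleteSpace (pathSpace ι) := hcl.completeSpace_coe
  have hdφ : ContDiffOn ℝ 1 (fderiv ℝ φ) U₁ := hφ2.fderiv_of_isOpen hU₁ (by norm_num)
  -- the multiplication operator `η ↦ dφ(ξ) η`
  set N : pathSpace ι × Lp H₁ 2 (volume : Measure ℝ) → Lp H₁ 2 (volume : Measure ℝ) := fun p =>
    mulLp (BoundedContinuousFunction.superpose (fderiv ℝ φ) (sobolevEmb ι hι_norm p.1)) p.2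
    with hN
  have hN1 : ContDiffOn ℝ 1 N (pathDomain ι U₁ ×ˢ univ) :=
    contDiffOn_mulLp_superpose hι_norm hU₁ h0 hdφ
  have hNc : ∀ ξ ∈ pathDomain ι U₁, ∀ η, ∀ᵐ s, N (ξ, η) s = fderiv ℝ φ (contRep ξ s) (η s) := by
    intro ξ hξ η
    filter_upwards [mulLp_ae_eq (BoundedContinuousFunction.superpose (fderiv ℝ φ)
      (sobolevEmb ι hι_norm ξ)) η] with s hs
    rw [superpose_sobolevEmb_apply hι_norm hU₁ h0 hdφ.continuousOn hξ] at hs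
    exact hs
  have hsup := fun (ξ : pathSpace ι) (hξ : ξ ∈ pathDomain ι U₁) =>
    superposeLp_and_derivSuperposeLp_ae_eq hι_norm hι_dense hT hU₁ h0 hψ2 hψ0 hξ
  -- The pair consisting of `ψ ∘ ξ` and its expected weak derivative `dφ(ξ) ξ'`, `C¹` into the
  -- ambient Hilbert sum.
  set J : pathSpace ι → WithLp 2 (Lp H₂ 2 (volume : Measure ℝ) × Lp H₁ 2 (volume : Measure ℝ)) :=
    fun ξ => (WithLp.prodContinuousLinearEquiv 2 ℝ (Lp H₂ 2 (volume : Measure ℝ))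
      (Lp H₁ 2 (volume : Measure ℝ))).symm (superposeLp ι ψ ξ, N (ξ, weakDerivL ι ξ)) with hJ
  have hJ1 : ContDiffOn ℝ 1 J (pathDomain ι U₁) := by
    refine (WithLp.prodContinuousLinearEquiv 2 ℝ (Lp H₂ 2 (volume : Measure ℝ))
      (Lp H₁ 2 (volume : Measure ℝ))).symm.contDiff.comp_contDiffOn
      ((contDiffOn_superposeLp hι_norm hι_dense hT hU₁ h0 hψ2 hψ0).prodMk ?_)
    exact hN1.comp (contDiff_id.prodMk (weakDerivL ι).contDiff).contDiffOn
      fun ξ hξ => ⟨hξ, mem_univ _⟩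
  have hιψ : ∀ ξ ∈ pathDomain ι U₁, (fun s => φ (contRep ξ s)) =ᵐ[volume]
      fun s => ι (superposeLp ι ψ ξ s) := by
    intro ξ hξ
    filter_upwards [(hsup ξ hξ).1, contRep_ae_eq ξ, ae_mem_of_mem_pathDomain hξ] with s h1 h2 h3
    rw [h1, hψφ _ h3, h2]
  have hJmem : ∀ ξ ∈ pathDomain ι U₁, J ξ ∈ pathSpace ι := by
    intro ξ hξ
    have hw := isWeakDeriv_comp_primitive hU₁ (hφ2.of_le (by norm_num))
      ((Lp.memLp (weakDerivL ι ξ)).locallyIntegrable (by norm_num)) _ (g := contRep ξ)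
      (fun _ => rfl) (mem_pathDomain_iff.1 hξ)
    exact hw.congr (hιψ ξ hξ) ((hNc ξ hξ (weakDerivL ι ξ)).mono fun s hs => hs.symm)
  -- On the domain `J` already lies in `pathSpace ι` and the projection changes nothing; it
  -- transfers the `C¹` property to the subspace and gives a value elsewhere.
  set Φ : pathSpace ι → pathSpace ι := fun ξ => (pathSpace ι).orthogonalProjectionOnto (J ξ)
    with hΦ
  have hΦ1 : ContDiffOn ℝ 1 Φ (pathDomain ι U₁) :=
    (pathSpace ι).orthogonalProjectionOnto.contDiff.comp_contDiffOn hJ1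
  have hΦp : ∀ ξ ∈ pathDomain ι U₁, pathOf (Φ ξ) = superposeLp ι ψ ξ := by
    intro ξ hξ
    have : Φ ξ = ⟨J ξ, hJmem ξ hξ⟩ :=
      Submodule.orthogonalProjectionOnto_mem_subspace_eq_self (⟨J ξ, hJmem ξ hξ⟩ : pathSpace ι)
    rw [this]
    rfl
  refine ⟨hopen, Φ, fun ξ hξ => ?_, hΦ1, fun ξ hξ ζ => ?_, fun p => (Φ p.1, N p),
    fun ξ hξ η => ⟨rfl, ?_⟩, ?_⟩
  · rw [hΦp ξ hξ]
    filter_upwards [hιψ ξ hξ, contRep_ae_eq ξ] with s h1 h2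
    rw [← h1, h2]
  · have hd1 : HasFDerivAt (fun ξ => pathOfL ι (Φ ξ)) ((pathOfL ι).comp (fderiv ℝ Φ ξ)) ξ :=
      (pathOfL ι).hasFDerivAt.comp ξ
        ((hΦ1.contDiffAt (hopen.mem_nhds hξ)).differentiableAt (by simp)).hasFDerivAt
    -- The derivative of `Φ` is known only abstractly; uniqueness of derivatives after `pathOfL`
    -- identifies its path.
    have hd2 : HasFDerivAt (fun ξ => pathOfL ι (Φ ξ)) (derivSuperposeLp ι ψ ξ) ξ :=
      (hasFDerivAt_superposeLp hι_norm hι_dense hT hU₁ h0 hψ2 hψ0 hξ).congr_of_eventuallyEq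
        (by filter_upwards [hopen.mem_nhds hξ] with ξ' hξ' using hΦp ξ' hξ')
    have e : pathOf (fderiv ℝ Φ ξ ζ) = derivSuperposeLp ι ψ ξ ζ :=
      congrArg (fun L => L ζ) (hd1.unique hd2)
    rw [e]
    filter_upwards [(hsup ξ hξ).2 ζ, ae_mem_of_mem_pathDomain hξ] with s h1 h2
    rw [h1]
    -- Differentiating `ι ∘ ψ = φ ∘ ι` in two ways converts `dψ` into `dφ`.
    have d1 : HasFDerivAt (fun y => ι (ψ y)) (ι.comp (fderiv ℝ ψ (pathOf ξ s))) (pathOf ξ s) :=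
      ι.hasFDerivAt.comp _
        ((hψ2.contDiffAt (hV.mem_nhds h2)).differentiableAt (by simp)).hasFDerivAt
    have d2 : HasFDerivAt (fun y => ι (ψ y)) ((fderiv ℝ φ (ι (pathOf ξ s))).comp ι)
        (pathOf ξ s) :=
      (((hφ2.contDiffAt (hU₁.mem_nhds h2)).differentiableAt (by simp)).hasFDerivAt.comp _
        ι.hasFDerivAt).congr_of_eventuallyEq
        (by filter_upwards [hV.mem_nhds h2] with y hy using hψφ y hy)
    exact congrArg (fun L => L (pathOf ζ s)) (d1.unique d2)
  · filter_upwards [hNc ξ hξ η, contRep_ae_eq ξ] with s h1 h2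
    rw [← h2]
    exact h1
  · exact (hΦ1.comp contDiff_fst.contDiffOn fun p hp => hp.1).prodMk hN1
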